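/- Consider Boolean circuits on input variables $x_1,\dots,x_N$ (directed acyclic graphs with one output) built from NOT gates and unbounded fan-in AND and OR gates. The size of a circuit is the number of its gates of fan-in larger than $1$; its depth is the length of the longest path to the output gate, where only gates of fan-in larger than $1$ are counted. A circuit is alternating if all NOT gates are directly above the input variables and AND and OR gates alternate along all paths to the output; it is layered if, for each gate, all paths from that gate to the output have the same length. Let $\mathsf{AC^0}[s,d]$ denote the set of alternating, layered AND/OR/NOT circuits of size at most $s$ and depth at most $d$. For $f:\{0,1\}^N\to\{0,1\}$, pairwise disjoint sets $B_1,\dots,B_k\subseteq[N]$, $B=\{B_1,\dots,B_k\}$, and $x\in\{0,1\}^N$, let \[ \mathrm{bs}_B^x(f) = \left|\left\{i\in[k] : f(x)\neq f\left(x^{\oplus B_i}\right)\right\}\right|, \] where $x^{\oplus S}$ is $x$ with all bits indexed by $S$ flipped. Then there is an absolute constant $c>0$ such that for all integers $N\ge 1$, $s,d,k\ge 0$ with $s+N\ge 2$, all functions $f:\{0,1\}^N\to\{0,1\}$ computed by a circuit in $\mathsf{AC^0}[s,d]$, all pairwise disjoint $B_1,\dots,B_k\subseteq[N]$, $B=\{B_1,\dots,B_k\}$,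 and all real $t$, \[ \Pr_{x\sim\{0,1\}^N}\left[\mathrm{bs}_B^x(f)\ge t\right] \le 4N\cdot 2^{-c^d\, t/(\log_2(s+N))^d}, \] where $x$ is uniformly distributed on $\{0,1\}^N$. In particular, the exponent is $-\Omega\left(t/(\log(s+N))^d\right)$ with an implied constant that depends only on $d$. -/

import Mathlib

/-- A node of a Boolean circuit with `N` input variables and `m` nodes. `input i` is the input
variable `x_i`; the other nodes are gates. `and` and `or` gates have unbounded fan-in. -/
inductive Node (N m : ℕ) where
  | input (i : Fin N)
  | not (u : Fin m)
  | and (S : Finset (Fin m))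
  | or (S : Finset (Fin m))

namespace Node

variable {N m : ℕ}

/-- The nodes that are wired into a given node. -/
def children : Node N m → Finset (Fin m)
  | input _ => ∅
  | not u => {u}
  | and S => S
  | or S => S

/-- The number of incoming wires. -/
def fanIn (g : Node N m) : ℕ := g.children.card

def IsInput (g : Node N m) : Prop := ∃ i, g = input i

def IsAnd (g : Node N m) : Prop := ∃ S, g = and S

def IsOr (g : Node N m) : Prop := ∃ S, g = or S

end Node

/-- A Boolean AND/OR/NOT circuit on `N` input variables: a directed acyclic graph whose nodes
`0, …, m - 1` are listed in topological order, with a designated output node. A node may be used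
by several other nodes. -/
structure BoolCircuit (N : ℕ) where
  m : ℕ
  node : Fin m → Node N m
  topo : ∀ v, ∀ u ∈ (node v).children, u < v
  out : Fin m

namespace BoolCircuit

variable {N : ℕ}

/-- The value of the node `v` on input `x`. -/
def val (C : BoolCircuit N) (x : Fin N → Bool) (v : Fin C.m) : Bool :=
  match h : C.node v with
  | Node.input i => x i
  | Node.not u => !(C.val x u)
  | Node.and S => decide (∀ u : {u // u ∈ S}, C.val x u.1 = true)
  | Node.or S => decide (∃ u : {u // u ∈ S}, C.val x u.1 = true)
termination_by v
decreasing_by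
  all_goals exact C.topo v _ (by simp [h, Node.children])

/-- The Boolean function computed by a circuit. -/
def eval (C : BoolCircuit N) (x : Fin N → Bool) : Bool := C.val x C.out

/-- The size of a circuit: the number of gates of fan-in larger than `1`. -/
def size (C : BoolCircuit N) : ℕ :=
  (Finset.univ.filter fun v => 1 < (C.node v).fanIn).card

/-- The largest number of gates of fan-in larger than `1` on a path that ends in `v`. -/
def depthAt (C : BoolCircuit N) (v : Fin C.m) : ℕ :=
  (Finset.univ.sup fun u : {u // u ∈ (C.node v).children} => C.depthAt u.1)
    + if 1 < (C.node v).fanIn then 1 else 0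
termination_by v
decreasing_by exact C.topo v _ u.2

/-- The depth of a circuit: the length of the longest path to the output gate, ignoring gates of
fan-in `1`. -/
def depth (C : BoolCircuit N) : ℕ := C.depthAt C.out

/-- `C.PathToOut v k`: there is a path with `k` wires from the node `v` to the output node. -/
inductive PathToOut (C : BoolCircuit N) : Fin C.m → ℕ → Prop
  | nil : PathToOut C C.out 0
  | cons {u v : Fin C.m} {k : ℕ} :
      u ∈ (C.node v).children → PathToOut C v k → PathToOut C u (k + 1)

/-- A circuit is alternating if all NOT gates are directly above the input variables, and the
AND and OR gates alternate along all paths to the output. -/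
def Alternating (C : BoolCircuit N) : Prop :=
  (∀ v u, C.node v = Node.not u → (C.node u).IsInput) ∧
  ∀ v k, C.PathToOut v k → ∀ u ∈ (C.node v).children,
    ¬ ((C.node u).IsAnd ∧ (C.node v).IsAnd) ∧ ¬ ((C.node u).IsOr ∧ (C.node v).IsOr)

/-- A circuit is layered if, for each gate, all paths from it to the output have the same
length. -/
def Layered (C : BoolCircuit N) : Prop :=
  ∀ v, ¬ (C.node v).IsInput → ∀ k l, C.PathToOut v k → C.PathToOut v l → k = l

end BoolCircuit

/-- `AC0 N s d`: the functions `{0,1}^N → {0,1}` that are computed by an alternating, layered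
AND/OR/NOT circuit of size at most `s` and depth at most `d`. -/
def AC0 (N s d : ℕ) : Set ((Fin N → Bool) → Bool) :=
  {f | ∃ C : BoolCircuit N, C.Alternating ∧ C.Layered ∧ C.size ≤ s ∧ C.depth ≤ d ∧
    ∀ x, C.eval x = f x}

/-- The string obtained from `x` by flipping all bits with index in `S`. -/
def flipBits {N : ℕ} (x : Fin N → Bool) (S : Finset (Fin N)) : Fin N → Bool :=
  fun i => if i ∈ S then !(x i) else x i

/-- The block sensitivity of `f` on input `x` with respect to the blocks `B_1, …, B_k`. -/
def blockSensitivity {N k : ℕ} (B : Fin k → Finset (Fin N)) (f : (Fin N → Bool) → Bool)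
    (x : Fin N → Bool) : ℕ :=
  (Finset.univ.filter fun i : Fin k => f x ≠ f (flipBits x (B i))).card

open scoped Classical in
/-- The probability of the event `P` for a uniformly random string `x ∈ {0,1}^N`. -/
noncomputable def probUniform (N : ℕ) (P : (Fin N → Bool) → Prop) : ℝ :=
  ((Finset.univ.filter P).card : ℝ) / 2 ^ N

/-! The theorem follows from an exponential moment bound: the average of `(1 + p) ^ bs` is at most
`2 ^ (d + r)`, where `d ≥ 1`, `r = ⌈log₂ (s + N)⌉` and `p` is of order `1 / (100 r) ^ (d - 1)`.
Markov's inequality then gives the tail.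

Blocks are reduced to single bits: for fixed `z`, flip block `B i` exactly when `y i` is true. Block
sensitivity becomes ordinary sensitivity in `y`, each circuit input depends on at most one `y i`,
and averaging over `z` recovers a uniform input (`sum_pow_blockSensitivity_le`).

For sensitivity, a restriction keeps each sensitive coordinate free with probability `q`,
independently, so the moment with base `1 + q p` equals the average, over restrictions, of the
moment `G` with base `1 + p` of the restricted function (`sum_pow_sens_eq_restrAvg`). Each
restriction makes one more level of gates computable by trees of depth `r`, at the cost of a factor
`2` (`sum_pow_sens_le_of_next_level`). When the output itself has depth `r`, its sensitivity is at
most `r`.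

A restriction may fail to simplify some gate, and `G` can be huge there, so bounding the probability
of failure is not enough. The switching lemma `weighted_switching` bounds the integral of `G` over
the failures. It uses only that `G` grows by a bounded factor when a variable is queried, which
holds since a query lowers sensitivity by at most one. `multi_switching` sums this over at most `2 ^
r` gates. -/

/-! ### Decision trees and partial assignments -/

section Restrictions

variable {V : Type*} [DecidableEq V]

/-- The input obtained from `x` by imposing the partial assignment `σ`. -/
def fill (σ : V → Option Bool) (x : V → Bool) : V → Bool := fun v => (σ v).getD (x v)

/-- `HasDepth n f`: the function `f` has a decision tree of depth at most `n`. -/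
def HasDepth : ℕ → ((V → Bool) → Bool) → Prop
  | 0, f => ∀ x y, f x = f y
  | n + 1, f => (∀ x y, f x = f y) ∨
      ∃ v, ∀ b, HasDepth n (fun x => f (Function.update x v b))

theorem HasDepth.of_const {f : (V → Bool) → Bool} (h : ∀ x y, f x = f y) (n : ℕ) :
    HasDepth n f := by
  cases n with
  | zero => exact h
  | succ n => exact Or.inl h

theorem HasDepth.succ {n : ℕ} {f : (V → Bool) → Bool} (h : HasDepth n f) :
    HasDepth (n + 1) f := by
  induction n generalizing f with
  | zero => exact HasDepth.of_const h _
  | succ n ih =>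
    rcases h with h | ⟨v, hv⟩
    · exact Or.inl h
    · exact Or.inr ⟨v, fun b => ih (hv b)⟩

theorem HasDepth.mono {m n : ℕ} (hmn : m ≤ n) {f : (V → Bool) → Bool} (h : HasDepth m f) :
    HasDepth n f := by
  induction hmn with
  | refl => exact h
  | step _ ih => exact ih.succ

theorem HasDepth.not {n : ℕ} {f : (V → Bool) → Bool} (h : HasDepth n f) :
    HasDepth n (fun x => !(f x)) := by
  induction n generalizing f with
  | zero => intro x y; simp only [h x y]
  | succ n ih =>
    rcases h with h | ⟨v, hv⟩
    · exact Or.inl fun x y => by simp only [h x y]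
    · exact Or.inr ⟨v, fun b => ih (hv b)⟩

theorem fill_update_none {σ : V → Option Bool} {v : V} (h : σ v = none) (x : V → Bool) (b : Bool) :
    fill σ (Function.update x v b) = Function.update (fill σ x) v b := by
  funext u
  by_cases hu : u = v
  · subst hu; simp [fill, h]
  · simp [fill, hu]

theorem fill_update_some (σ : V → Option Bool) (v : V) (x : V → Bool) (b : Bool) :
    fill (Function.update σ v (some b)) x = Function.update (fill σ x) v b := by
  funext u
  by_cases hu : u = v
  · subst hu; simp [fill]
  · simp [fill, hu]

theorem HasDepth.fill {n : ℕ} {f : (V → Bool) → Bool} (h : HasDepth n f) (σ : V → Option Bool) :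
    HasDepth n (fun x => f (fill σ x)) := by
  induction n generalizing f with
  | zero => exact fun x y => h _ _
  | succ n ih =>
    rcases h with h | ⟨v, hv⟩
    · exact Or.inl fun x y => h _ _
    · cases hσ : σ v with
      | none =>
        refine Or.inr ⟨v, fun b => ?_⟩
        simp only [fill_update_none hσ]
        exact ih (hv b)
      | some b =>
        -- A query to a variable that `σ` has set is answered by `σ`, so only the branch `b`
        -- matters.
        have h1 := (ih (hv b)).succ
        have h2 : ∀ x, Function.update (_root_.fill σ x) v b = _root_.fill σ x := by
          intro x
          have : b = _root_.fill σ x v := by simp [_root_.fill, hσ]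
          rw [this, Function.update_eq_self]
        simpa only [h2] using h1

/-- A function of small decision tree depth has a small certificate at every input. -/
theorem HasDepth.exists_certificate {n : ℕ} {f : (V → Bool) → Bool} (h : HasDepth n f)
    (x : V → Bool) :
    ∃ K : Finset V, K.card ≤ n ∧ ∀ y, (∀ v ∈ K, y v = x v) → f y = f x := by
  induction n generalizing f with
  | zero => exact ⟨∅, by simp, fun y _ => h _ _⟩
  | succ n ih =>
    rcases h with h | ⟨v, hv⟩
    · exact ⟨∅, by simp, fun y _ => h _ _⟩
    · obtain ⟨K, hK, hc⟩ := ih (hv (x v))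
      refine ⟨insert v K, (Finset.card_insert_le _ _).trans (by omega), fun y hy => ?_⟩
      have h1 := hc y fun u hu => hy u (Finset.mem_insert_of_mem hu)
      rw [← hy v (Finset.mem_insert_self _ _), Function.update_eq_self,
        hy v (Finset.mem_insert_self _ _), Function.update_eq_self] at h1
      exact h1

/-- The partial assignment `σ` overwritten on `K` by the values of `κ`. -/
def fixOn (K : Finset V) (κ : V → Bool) (σ : V → Option Bool) : V → Option Bool :=
  fun v => if v ∈ K then some (κ v) else σ v

/-- The partial assignment `σ` overwritten on `K`: the variables in `A` become free, the others
take the values of `b`. -/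
def starOn (K A : Finset V) (b : V → Bool) (σ : V → Option Bool) : V → Option Bool :=
  fun v => if v ∈ A then none else if v ∈ K then some (b v) else σ v

/-- Query all of `A` first; `B` records the variables answered `true`, and each leaf continues with
its own tree of depth `m`. -/
theorem HasDepth.of_fixOn {m : ℕ} {f : (V → Bool) → Bool} (A : Finset V) {σ : V → Option Bool}
    (hσ : ∀ v ∈ A, σ v = none)
    (h : ∀ B ∈ A.powerset,
      HasDepth m fun x => f (_root_.fill (fixOn A (fun v => decide (v ∈ B)) σ) x)) :
    HasDepth (m + A.card) fun x => f (_root_.fill σ x) := by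
  induction A using Finset.induction_on generalizing σ with
  | empty =>
    have h1 : fixOn ∅ (fun v => decide (v ∈ (∅ : Finset V))) σ = σ := by funext v; simp [fixOn]
    have h2 := h ∅ (by simp)
    rwa [h1] at h2
  | insert v A hv ih =>
    rw [Finset.card_insert_of_notMem hv, ← add_assoc]
    refine Or.inr ⟨v, fun b => ?_⟩
    have h0 : σ v = none := hσ v (Finset.mem_insert_self _ _)
    simp only [fill_update_none h0]
    simp only [← fill_update_some]
    refine ih ?_ ?_
    · intro u hu
      have : u ≠ v := fun h => hv (h ▸ hu)
      rw [Function.update_of_ne this]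
      exact hσ u (Finset.mem_insert_of_mem hu)
    · intro B hB
      rw [Finset.mem_powerset] at hB
      have hvB : v ∉ B := fun h => hv (hB h)
      have key := h (if b then insert v B else B) (by
        rw [Finset.mem_powerset]
        split_ifs
        · exact Finset.insert_subset_insert _ hB
        · exact hB.trans (Finset.subset_insert _ _))
      have : fixOn (insert v A) (fun u => decide (u ∈ if b then insert v B else B)) σ =
          fixOn A (fun u => decide (u ∈ B)) (Function.update σ v (some b)) := by
        funext u
        by_cases hu : u = v
        · subst hu
          cases b <;> simp [fixOn, hv, hvB]
        · cases b <;> simp [fixOn, hu]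
      rwa [this] at key

/-! ### Averages over random restrictions -/

variable [Fintype V]

/-- The probability of each value of a variable under a random restriction. -/
noncomputable def starWeight (q : ℝ) : Option Bool → ℝ
  | none => q
  | some _ => (1 - q) / 2

/-- The expectation of `Φ` under a random restriction that leaves each variable free with
probability `q` and sets it to a uniformly random bit otherwise. -/
noncomputable def restrAvg (q : ℝ) (Φ : (V → Option Bool) → ℝ) : ℝ :=
  ∑ σ, (∏ v, starWeight q (σ v)) * Φ σ

theorem starWeight_nonneg {q : ℝ} (h0 : 0 ≤ q) (h1 : q ≤ 1) (o : Option Bool) :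
    0 ≤ starWeight q o := by
  cases o
  · exact h0
  · simp only [starWeight]; linarith

theorem restrAvg_mono {q : ℝ} (h0 : 0 ≤ q) (h1 : q ≤ 1) {Φ Ψ : (V → Option Bool) → ℝ}
    (h : ∀ σ, Φ σ ≤ Ψ σ) : restrAvg q Φ ≤ restrAvg q Ψ :=
  Finset.sum_le_sum fun σ _ =>
    mul_le_mul_of_nonneg_left (h σ) (Finset.prod_nonneg fun _ _ => starWeight_nonneg h0 h1 _)

theorem restrAvg_nonneg {q : ℝ} (h0 : 0 ≤ q) (h1 : q ≤ 1) {Φ : (V → Option Bool) → ℝ}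
    (h : ∀ σ, 0 ≤ Φ σ) : 0 ≤ restrAvg q Φ :=
  Finset.sum_nonneg fun σ _ =>
    mul_nonneg (Finset.prod_nonneg fun _ _ => starWeight_nonneg h0 h1 _) (h σ)

theorem restrAvg_add (q : ℝ) (Φ Ψ : (V → Option Bool) → ℝ) :
    restrAvg q (fun σ => Φ σ + Ψ σ) = restrAvg q Φ + restrAvg q Ψ := by
  simp only [restrAvg, mul_add, Finset.sum_add_distrib]

theorem restrAvg_const_mul (q c : ℝ) (Φ : (V → Option Bool) → ℝ) :
    restrAvg q (fun σ => c * Φ σ) = c * restrAvg q Φ := by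
  simp only [restrAvg, Finset.mul_sum]
  exact Finset.sum_congr rfl fun σ _ => by ring

theorem restrAvg_sum (q : ℝ) {ι : Type*} (s : Finset ι) (Φ : ι → (V → Option Bool) → ℝ) :
    restrAvg q (fun σ => ∑ i ∈ s, Φ i σ) = ∑ i ∈ s, restrAvg q (Φ i) := by
  simp only [restrAvg, Finset.mul_sum]
  exact Finset.sum_comm

theorem restrAvg_split (q : ℝ) (v : V) (Φ : (V → Option Bool) → ℝ) :
    restrAvg q Φ = ∑ o, starWeight q o * restrAvg q (fun σ => Φ (Function.update σ v o)) := by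
  have hw : ∀ (σ : V → Option Bool) (o : Option Bool),
      (∏ u, starWeight q (Function.update σ v o u)) * starWeight q (σ v) =
        starWeight q o * ∏ u, starWeight q (σ u) := by
    intro σ o
    rw [← Finset.mul_prod_erase _ _ (Finset.mem_univ v),
      ← Finset.mul_prod_erase _ (fun u => starWeight q (σ u)) (Finset.mem_univ v)]
    have : ∏ u ∈ Finset.univ.erase v, starWeight q (Function.update σ v o u) =
        ∏ u ∈ Finset.univ.erase v, starWeight q (σ u) :=
      Finset.prod_congr rfl fun u hu => by rw [Function.update_of_ne (Finset.ne_of_mem_erase hu)]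
    rw [this, Function.update_self]
    ring
  have hs : ∑ o, starWeight q o = 1 := by
    simp [Fintype.sum_option, starWeight]
    ring
  -- Exchanging the value at `v` with an independent fresh copy is an involution that preserves the
  -- product weight.
  let e : Option Bool × (V → Option Bool) ≃ Option Bool × (V → Option Bool) :=
    { toFun := fun a => (a.2 v, Function.update a.2 v a.1)
      invFun := fun a => (a.2 v, Function.update a.2 v a.1)
      left_inv := fun a => by simp
      right_inv := fun a => by simp }
  calc restrAvg q Φ = (∑ o, starWeight q o) * restrAvg q Φ := by rw [hs, one_mul]
    _ = ∑ a : Option Bool × (V → Option Bool),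
          starWeight q a.1 * ((∏ u, starWeight q (a.2 u)) * Φ a.2) := by
        rw [Fintype.sum_prod_type, restrAvg, Finset.sum_mul_sum]
    _ = ∑ a : Option Bool × (V → Option Bool),
          starWeight q (e a).1 * ((∏ u, starWeight q ((e a).2 u)) * Φ (e a).2) :=
        (Equiv.sum_comp e _).symm
    _ = ∑ a : Option Bool × (V → Option Bool),
          starWeight q a.1 * ((∏ u, starWeight q (a.2 u)) * Φ (Function.update a.2 v a.1)) := by
        refine Finset.sum_congr rfl fun a _ => ?_
        simp only [e, Equiv.coe_fn_mk]
        rw [← mul_assoc, ← mul_assoc, ← hw a.2 a.1]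
        ring
    _ = _ := by
        rw [Fintype.sum_prod_type]
        simp only [restrAvg, Finset.mul_sum]

open scoped Classical in
/-- The part of the expectation in which no variable of `K` is set against `b`, split according
to the free variables in `K`. -/
theorem restrAvg_consistent (q : ℝ) (K : Finset V) (b : V → Bool) (Φ : (V → Option Bool) → ℝ) :
    restrAvg q (fun σ => if ∀ v ∈ K, σ v ≠ some (!(b v)) then Φ σ else 0) =
      ∑ A ∈ K.powerset, q ^ A.card * ((1 - q) / 2) ^ (K.card - A.card) *
        restrAvg q (fun σ => Φ (starOn K A b σ)) := by
  induction K using Finset.induction_on generalizing Φ with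
  | empty =>
    have h1 : ∀ σ, starOn ∅ ∅ b σ = σ := fun σ => by funext v; simp [starOn]
    simp [h1]
  | insert v K hv ih =>
    have h1 : (fun σ : V → Option Bool =>
          if ∀ u ∈ insert v K, σ u ≠ some (!(b u)) then Φ σ else 0) =
        fun σ => if ∀ u ∈ K, σ u ≠ some (!(b u)) then
          (if σ v ≠ some (!(b v)) then Φ σ else 0) else 0 := by
      funext σ
      rw [← ite_and]
      refine if_congr ?_ rfl rfl
      rw [Finset.forall_mem_insert, and_comm]
    rw [h1, ih, Finset.sum_powerset_insert hv, ← Finset.sum_add_distrib]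
    refine Finset.sum_congr rfl fun A hA => ?_
    rw [Finset.mem_powerset] at hA
    have hvA : v ∉ A := fun h => hv (hA h)
    have hc : A.card ≤ K.card := Finset.card_le_card hA
    rw [restrAvg_split q v, Fintype.sum_option, Fintype.sum_bool]
    have e1 : ∀ σ : V → Option Bool, starOn K A b (Function.update σ v none) =
        starOn (insert v K) (insert v A) b σ := by
      intro σ; funext u
      by_cases hu : u = v
      · subst hu; simp [starOn, hv, hvA]
      · simp [starOn, hu]
    have e2 : ∀ σ : V → Option Bool, starOn K A b (Function.update σ v (some (b v))) =
        starOn (insert v K) A b σ := by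
      intro σ; funext u
      by_cases hu : u = v
      · subst hu; simp [starOn, hv, hvA]
      · simp [starOn, hu]
    have e3 : ∀ (σ : V → Option Bool) o, starOn K A b (Function.update σ v o) v = o := by
      intro σ o; simp [starOn, hv, hvA]
    have z : restrAvg q (fun _ : V → Option Bool => (0 : ℝ)) = 0 := by simp [restrAvg]
    rw [Finset.card_insert_of_notMem hv, Finset.card_insert_of_notMem hvA,
      Nat.add_sub_add_right, Nat.sub_add_comm hc]
    simp only [e3]
    cases hb : b v
    · rw [hb] at e2
      simp [starWeight, e1, e2, z]
      ring
    · rw [hb] at e2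
      simp [starWeight, e1, e2, z]
      ring

end Restrictions

/-! ### The weighted switching lemma -/

section Switching

variable {V : Type*}

/-- `σ` is refined by `σ'`: every variable set by `σ` has the same value in `σ'`. -/
def Refines (σ σ' : V → Option Bool) : Prop := ∀ v, σ v = none ∨ σ v = σ' v

/-- Nonnegative weights that do not decrease when free variables are set. -/
structure IsMonoWeight (D : (V → Option Bool) → ℝ) : Prop where
  nonneg : ∀ σ, 0 ≤ D σ
  mono : ∀ σ σ', Refines σ σ' → D σ ≤ D σ'

theorem IsMonoWeight.one : IsMonoWeight (fun _ : V → Option Bool => (1 : ℝ)) :=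
  ⟨fun _ => zero_le_one, fun _ _ _ => le_rfl⟩

-- A falsified literal stays falsified when more variables are set. Conditioning on a term being
-- falsified therefore yields another admissible weight, which the induction over terms needs.
open scoped Classical in
theorem IsMonoWeight.falsified {D : (V → Option Bool) → ℝ} (hD : IsMonoWeight D)
    (K : Finset V) (b : V → Bool) :
    IsMonoWeight (fun σ => if ∀ v ∈ K, σ v ≠ some (!(b v)) then 0 else D σ) := by
  refine ⟨fun σ => ?_, fun σ σ' h => ?_⟩
  · split_ifs
    · exact le_rfl
    · exact hD.nonneg _
  · by_cases h1 : ∀ v ∈ K, σ v ≠ some (!(b v))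
    · rw [if_pos h1]
      split_ifs
      · exact le_rfl
      · exact hD.nonneg _
    · rw [if_neg h1, if_neg]
      · exact hD.mono _ _ h
      · intro h2
        refine h1 fun v hv h3 => h2 v hv ?_
        rcases h v with h4 | h4
        · rw [h3] at h4; cases h4
        · rw [← h4, h3]

/-- The Boolean function of a disjunction of terms; the term `(S, b)` is satisfied by `x` if `x`
agrees with `b` on `S`. -/
def dnf (F : List (Finset V × (V → Bool))) (x : V → Bool) : Bool :=
  F.any fun T => decide (∀ v ∈ T.1, x v = T.2 v)

theorem dnf_cons_of_sat {F : List (Finset V × (V → Bool))} {T : Finset V × (V → Bool)}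
    {x : V → Bool} (h : ∀ v ∈ T.1, x v = T.2 v) : dnf (T :: F) x = true := by
  simp only [dnf, List.any_cons, decide_eq_true h, Bool.true_or]

theorem dnf_cons_of_not_sat {F : List (Finset V × (V → Bool))} {T : Finset V × (V → Bool)}
    {x : V → Bool} (h : ∃ v ∈ T.1, x v ≠ T.2 v) : dnf (T :: F) x = dnf F x := by
  have : ¬ ∀ v ∈ T.1, x v = T.2 v := fun h' => by
    obtain ⟨v, hv, hn⟩ := h
    exact hn (h' v hv)
  simp only [dnf, List.any_cons, decide_eq_false this, Bool.false_or]

variable [DecidableEq V]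

theorem IsMonoWeight.comp_starOn {D : (V → Option Bool) → ℝ} (hD : IsMonoWeight D)
    (K A : Finset V) (b : V → Bool) : IsMonoWeight (fun σ => D (starOn K A b σ)) := by
  refine ⟨fun σ => hD.nonneg _, fun σ σ' h => hD.mono _ _ fun v => ?_⟩
  simp only [starOn]
  split_ifs
  · exact Or.inl rfl
  · exact Or.inr rfl
  · exact h v

/-- The number of queries needed does not grow when a term that is already decided is added. -/
theorem HasDepth.dnf_cons {n : ℕ} {F : List (Finset V × (V → Bool))}
    {T : Finset V × (V → Bool)} {ρ : V → Option Bool} (hρ : ∀ v ∈ T.1, ρ v ≠ none)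
    (h : HasDepth n fun x => dnf F (_root_.fill ρ x)) :
    HasDepth n fun x => dnf (T :: F) (_root_.fill ρ x) := by
  by_cases hs : ∀ v ∈ T.1, ρ v = some (T.2 v)
  · refine HasDepth.of_const (fun x y => ?_) n
    rw [dnf_cons_of_sat, dnf_cons_of_sat] <;>
    · intro v hv
      simp [_root_.fill, hs v hv]
  · push Not at hs
    obtain ⟨v, hv, hne⟩ := hs
    have : ∀ x, dnf (T :: F) (_root_.fill ρ x) = dnf F (_root_.fill ρ x) := fun x => by
      refine dnf_cons_of_not_sat ⟨v, hv, fun h' => ?_⟩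
      cases hb : ρ v with
      | none => exact hρ v hv hb
      | some c =>
        rw [hb] at hne
        simp only [_root_.fill, hb, Option.getD_some] at h'
        exact hne (by rw [h'])
    simpa only [this] using h

/-- Iterate the one-variable bound along `A`: each query costs a factor `2` and splits into two
answers. -/
theorem le_sum_fixOn {G : (V → Option Bool) → ℝ}
    (hG : ∀ σ v, G σ ≤ 2 * (G (Function.update σ v (some true)) +
      G (Function.update σ v (some false)))) (A : Finset V) (σ : V → Option Bool) :
    G σ ≤ 2 ^ A.card * ∑ B ∈ A.powerset, G (fixOn A (fun v => decide (v ∈ B)) σ) := by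
  induction A using Finset.induction_on generalizing σ with
  | empty =>
    have h1 : fixOn ∅ (fun v => decide (v ∈ (∅ : Finset V))) σ = σ := by funext v; simp [fixOn]
    rw [Finset.powerset_empty, Finset.sum_singleton, h1]
    simp
  | insert v A hv ih =>
    rw [Finset.card_insert_of_notMem hv, Finset.sum_powerset_insert hv]
    have e1 : ∀ B ∈ A.powerset, fixOn A (fun u => decide (u ∈ B)) (Function.update σ v (some false))
        = fixOn (insert v A) (fun u => decide (u ∈ B)) σ := by
      intro B hB
      have hvB : v ∉ B := fun h => hv (Finset.mem_powerset.1 hB h)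
      funext u
      by_cases hu : u = v
      · subst hu; simp [fixOn, hv, hvB]
      · simp [fixOn, hu]
    have e2 : ∀ B ∈ A.powerset, fixOn A (fun u => decide (u ∈ B)) (Function.update σ v (some true))
        = fixOn (insert v A) (fun u => decide (u ∈ insert v B)) σ := by
      intro B hB
      funext u
      by_cases hu : u = v
      · subst hu; simp [fixOn, hv]
      · simp [fixOn, hu]
    have h1 := ih (Function.update σ v (some false))
    have h2 := ih (Function.update σ v (some true))
    rw [Finset.sum_congr rfl fun B hB => by rw [e1 B hB]] at h1
    rw [Finset.sum_congr rfl fun B hB => by rw [e2 B hB]] at h2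
    have h3 := hG σ v
    rw [pow_succ]
    linarith

variable [Fintype V]

open scoped Classical in
/-- A switching lemma for disjunctions of narrow terms under a random restriction, weighted by a
function `G` that is at most four times its average after a query of a variable. The inputs at
which the depth and `G` are evaluated need not agree on the set `K` of fixed variables. -/
theorem weighted_switching {q : ℝ} (hq0 : 0 ≤ q) (hq1 : q ≤ 1) {w : ℕ}
    (hw : ∀ a ≤ w, (16 * q + (1 - q) / 2) ^ a ≤ 2 * ((1 - q) / 2) ^ a)
    {G : (V → Option Bool) → ℝ} (hG0 : ∀ σ, 0 ≤ G σ)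
    (hG : ∀ σ v, G σ ≤ 2 * (G (Function.update σ v (some true)) +
      G (Function.update σ v (some false))))
    {M : ℝ} (hM : 0 ≤ M) (F : List (Finset V × (V → Bool))) (hF : ∀ T ∈ F, T.1.card ≤ w)
    (K : Finset V)
    (hyp : ∀ K', K ⊂ K' → ∀ (κ : V → Bool) (D : (V → Option Bool) → ℝ), IsMonoWeight D →
      restrAvg q (fun σ => D σ * G (fixOn K' κ σ)) ≤ M * restrAvg q D)
    (κ τ : V → Bool) {D : (V → Option Bool) → ℝ} (hD : IsMonoWeight D) (u : ℕ) :
    2 ^ (u + 1) * restrAvg q (fun σ =>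
        if HasDepth u fun x => dnf F (fill (fixOn K τ σ) x) then 0
        else D σ * G (fixOn K κ σ)) ≤ M * restrAvg q D := by
  induction F generalizing K κ τ D u with
  | nil =>
    have : ∀ σ, HasDepth u fun x => dnf [] (fill (fixOn K τ σ) x) := fun σ =>
      HasDepth.of_const (fun x y => rfl) u
    simp only [this, if_true]
    have h0 : restrAvg q (fun _ : V → Option Bool => (0 : ℝ)) = 0 := by simp [restrAvg]
    rw [h0, mul_zero]
    exact mul_nonneg hM (restrAvg_nonneg hq0 hq1 hD.nonneg)
  | cons T F ih =>
    have hF' : ∀ T ∈ F, T.1.card ≤ w := fun T' hT' => hF T' (List.mem_cons_of_mem _ hT')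
    -- If the fixed values already contradict `T`, the term can be dropped. Otherwise only its
    -- variables outside `K` are still random.
    by_cases hfal : ∃ v ∈ T.1, v ∈ K ∧ τ v ≠ T.2 v
    · obtain ⟨v, hvT, hvK, hne⟩ := hfal
      have : ∀ σ x, dnf (T :: F) (fill (fixOn K τ σ) x) = dnf F (fill (fixOn K τ σ) x) := by
        intro σ x
        refine dnf_cons_of_not_sat ⟨v, hvT, ?_⟩
        simpa [fill, fixOn, hvK] using hne
      simp only [this]
      exact ih hF' K hyp κ τ hD u
    push Not at hfal
    set S := T.1 \ K with hS
    have hSw : S.card ≤ w :=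
      (Finset.card_le_card Finset.sdiff_subset).trans (hF T List.mem_cons_self)
    set h : ℝ := (1 - q) / 2 with hh
    have hh0 : 0 ≤ h := by rw [hh]; linarith
    set Φ : (V → Option Bool) → ℝ := fun σ =>
        if HasDepth u fun x => dnf (T :: F) (fill (fixOn K τ σ) x) then 0
        else D σ * G (fixOn K κ σ) with hΦ
    have hΦ0 : ∀ σ, 0 ≤ Φ σ := by
      intro σ
      simp only [hΦ]
      split_ifs
      · exact le_rfl
      · exact mul_nonneg (hD.nonneg _) (hG0 _)
    -- the restrictions that falsify the first term
    have part1 : 2 ^ (u + 1) * restrAvg q (fun σ =>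
          if ∀ v ∈ S, σ v ≠ some (!(T.2 v)) then 0 else Φ σ) ≤
        M * restrAvg q (fun σ => if ∀ v ∈ S, σ v ≠ some (!(T.2 v)) then 0 else D σ) := by
      refine le_trans ?_ ((ih hF' K hyp κ τ (hD.falsified S T.2) u).trans_eq (by congr!))
      refine mul_le_mul_of_nonneg_left (restrAvg_mono hq0 hq1 fun σ => ?_) (by positivity)
      by_cases hc : ∀ v ∈ S, σ v ≠ some (!(T.2 v))
      · rw [if_pos hc, if_pos hc]
        split_ifs <;> simp
      · rw [if_neg hc, if_neg hc]
        push Not at hc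
        obtain ⟨v, hvS, hv⟩ := hc
        rw [hS, Finset.mem_sdiff] at hvS
        have : ∀ x, dnf (T :: F) (fill (fixOn K τ σ) x) = dnf F (fill (fixOn K τ σ) x) := by
          intro x
          refine dnf_cons_of_not_sat ⟨v, hvS.1, ?_⟩
          simp [fill, fixOn, hvS.2, hv]
        simp only [hΦ, this]
        exact le_rfl
    -- the restrictions that leave exactly the variables in `A` of the first term free
    have partA : ∀ A ∈ S.powerset, 2 ^ (u + 1) * restrAvg q (fun σ => Φ (starOn S A T.2 σ)) ≤
        (if A = ∅ then 0 else 16 ^ A.card) * (M * restrAvg q (fun σ => D (starOn S ∅ T.2 σ))) := by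
      intro A hA
      rw [Finset.mem_powerset] at hA
      by_cases hA0 : A = ∅
      · rw [if_pos hA0, zero_mul, hA0]
        have : ∀ σ, Φ (starOn S ∅ T.2 σ) = 0 := by
          intro σ
          simp only [hΦ]
          rw [if_pos]
          refine HasDepth.of_const (fun x y => ?_) u
          rw [dnf_cons_of_sat, dnf_cons_of_sat] <;>
          · intro v hv
            by_cases hvK : v ∈ K
            · simpa [fill, fixOn, hvK] using hfal v hv hvK
            · simp [fill, fixOn, hvK, starOn, hS, hv]
        simp [this, restrAvg]
      rw [if_neg hA0]
      set D' : (V → Option Bool) → ℝ := fun σ => D (starOn S A T.2 σ) with hD'def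
      have hD' : IsMonoWeight D' := hD.comp_starOn S A T.2
      have hDle : restrAvg q D' ≤ restrAvg q (fun σ => D (starOn S ∅ T.2 σ)) := by
        refine restrAvg_mono hq0 hq1 fun σ => hD.mono _ _ fun v => ?_
        by_cases hv : v ∈ A
        · left; simp [starOn, hv]
        · right; simp [starOn, hv]
      -- The assignment on `K ∪ S` once the free variables `A` of the term are queried: `t` on `K`,
      -- the answers `B` on `A`, and the values satisfying `T` on the rest of `S`.
      set ext : (V → Bool) → Finset V → V → Bool := fun t B v =>
        if v ∈ K then t v else if v ∈ A then decide (v ∈ B) else T.2 v with hext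
      have hfix : ∀ t B σ, fixOn A (fun v => decide (v ∈ B)) (fixOn K t (starOn S A T.2 σ)) =
          fixOn (K ∪ S) (ext t B) σ := by
        intro t B σ
        funext v
        by_cases hvA : v ∈ A
        · have hvS := hA hvA
          have hvK : v ∉ K := (Finset.mem_sdiff.1 hvS).2
          simp [fixOn, hext, hvA, hvS, hvK]
        · by_cases hvK : v ∈ K
          · simp [fixOn, hext, hvA, hvK]
          · by_cases hvS : v ∈ S <;> simp [fixOn, hext, starOn, hvA, hvK, hvS]
      -- Since `A` is nonempty the fixed set grows strictly, so `hyp` applies to `K ∪ S`.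
      have hKS : K ⊂ K ∪ S := by
        obtain ⟨v, hv⟩ := Finset.nonempty_iff_ne_empty.2 hA0
        refine Finset.ssubset_iff_subset_ne.2 ⟨Finset.subset_union_left, fun hE => ?_⟩
        have h1 : v ∈ K := by rw [hE]; exact Finset.mem_union_right _ (hA hv)
        exact (Finset.mem_sdiff.1 (hA hv)).2 h1
      have hGle : ∀ σ, G (fixOn K κ (starOn S A T.2 σ)) ≤
          2 ^ A.card * ∑ B ∈ A.powerset, G (fixOn (K ∪ S) (ext κ B) σ) := by
        intro σ
        have := le_sum_fixOn hG A (fixOn K κ (starOn S A T.2 σ))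
        simpa only [hfix] using this
      have hfin : 16 ^ A.card * (M * restrAvg q D') ≤
          16 ^ A.card * (M * restrAvg q (fun σ => D (starOn S ∅ T.2 σ))) := by gcongr
      refine le_trans ?_ hfin
      by_cases hau : A.card ≤ u
      · have hΦle : ∀ σ, Φ (starOn S A T.2 σ) ≤ 2 ^ A.card * ∑ B ∈ A.powerset,
            ∑ B' ∈ A.powerset,
              if HasDepth (u - A.card) fun x => dnf F (fill (fixOn (K ∪ S) (ext τ B') σ) x) then 0
              else D' σ * G (fixOn (K ∪ S) (ext κ B) σ) := by
          intro σ
          have hnn : ∀ B B', 0 ≤ if HasDepth (u - A.card) fun x =>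
                dnf F (fill (fixOn (K ∪ S) (ext τ B') σ) x) then 0
              else D' σ * G (fixOn (K ∪ S) (ext κ B) σ) := by
            intro B B'
            split_ifs
            · exact le_rfl
            · exact mul_nonneg (hD'.nonneg _) (hG0 _)
          simp only [hΦ]
          split_ifs with hd
          · exact mul_nonneg (by positivity)
              (Finset.sum_nonneg fun B _ => Finset.sum_nonneg fun B' _ => hnn B B')
          -- If every answer left depth `u - A.card`, querying `A` first would give depth `u`. The
          -- failing answer `B'` is unrelated to the answer `B` chosen for `G`, which is why `κ` and
          -- `τ` are kept separate.
          · have : ∃ B' ∈ A.powerset, ¬ HasDepth (u - A.card) fun x =>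
                dnf F (fill (fixOn (K ∪ S) (ext τ B') σ) x) := by
              by_contra hcon
              push Not at hcon
              apply hd
              have h2 := HasDepth.of_fixOn (m := u - A.card) (f := dnf (T :: F)) A
                (σ := fixOn K τ (starOn S A T.2 σ)) (by
                  intro v hv
                  have hvK : v ∉ K := (Finset.mem_sdiff.1 (hA hv)).2
                  simp [fixOn, starOn, hv, hvK]) (by
                  intro B' hB'
                  rw [hfix]
                  refine HasDepth.dnf_cons (fun v hv => ?_) (hcon B' hB')
                  have : v ∈ K ∪ S := by
                    by_cases hvK : v ∈ K <;> simp [hS, hv, hvK]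
                  simp [fixOn, this])
              rwa [Nat.sub_add_cancel hau] at h2
            obtain ⟨B', hB', hn⟩ := this
            calc D (starOn S A T.2 σ) * G (fixOn K κ (starOn S A T.2 σ))
                ≤ D' σ * (2 ^ A.card * ∑ B ∈ A.powerset, G (fixOn (K ∪ S) (ext κ B) σ)) :=
                  mul_le_mul_of_nonneg_left (hGle σ) (hD'.nonneg _)
              _ = 2 ^ A.card * ∑ B ∈ A.powerset, D' σ * G (fixOn (K ∪ S) (ext κ B) σ) := by
                  rw [Finset.mul_sum, Finset.mul_sum, Finset.mul_sum]
                  exact Finset.sum_congr rfl fun _ _ => by ring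
              _ ≤ _ := by
                  refine mul_le_mul_of_nonneg_left (Finset.sum_le_sum fun B _ => ?_)
                    (by positivity)
                  refine le_trans ?_ (Finset.single_le_sum (fun B' _ => hnn B B') hB')
                  rw [if_neg hn]
        have hsum := restrAvg_mono hq0 hq1 hΦle
        simp only [restrAvg_const_mul, restrAvg_sum] at hsum
        have hone : ∀ B ∈ A.powerset, ∀ B' ∈ A.powerset, 2 ^ (u - A.card + 1) *
            restrAvg q (fun σ => if HasDepth (u - A.card) fun x =>
                dnf F (fill (fixOn (K ∪ S) (ext τ B') σ) x) then 0
              else D' σ * G (fixOn (K ∪ S) (ext κ B) σ)) ≤ M * restrAvg q D' := fun B _ B' _ =>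
          ih hF' (K ∪ S) (fun K' hK' => hyp K' (hKS.trans hK')) (ext κ B) (ext τ B') hD'
            (u - A.card)
        have hpow : (2 : ℝ) ^ (u + 1) = 2 ^ A.card * 2 ^ (u - A.card + 1) := by
          rw [← pow_add]; congr 1; omega
        -- Four factors of `2` per free variable: the growth of `G`, the answers `B`, the answers
        -- `B'`, and the lost depth.
        have h16 : (16 : ℝ) ^ A.card = 2 ^ A.card * 2 ^ A.card * 2 ^ A.card * 2 ^ A.card := by
          rw [← mul_pow, ← mul_pow, ← mul_pow]; norm_num
        calc 2 ^ (u + 1) * restrAvg q (fun σ => Φ (starOn S A T.2 σ))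
            ≤ 2 ^ (u + 1) * (2 ^ A.card * ∑ B ∈ A.powerset, ∑ B' ∈ A.powerset,
                restrAvg q (fun σ => if HasDepth (u - A.card) fun x =>
                  dnf F (fill (fixOn (K ∪ S) (ext τ B') σ) x) then 0
                else D' σ * G (fixOn (K ∪ S) (ext κ B) σ))) :=
              mul_le_mul_of_nonneg_left hsum (by positivity)
          _ = 2 ^ A.card * 2 ^ A.card * ∑ B ∈ A.powerset, ∑ B' ∈ A.powerset,
                2 ^ (u - A.card + 1) * restrAvg q (fun σ => if HasDepth (u - A.card) fun x =>
                  dnf F (fill (fixOn (K ∪ S) (ext τ B') σ) x) then 0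
                else D' σ * G (fixOn (K ∪ S) (ext κ B) σ)) := by
              rw [hpow]
              simp only [← Finset.mul_sum]
              ring
          _ ≤ 2 ^ A.card * 2 ^ A.card * ∑ B ∈ A.powerset, ∑ B' ∈ A.powerset,
                M * restrAvg q D' := by
              refine mul_le_mul_of_nonneg_left ?_ (by positivity)
              exact Finset.sum_le_sum fun B hB => Finset.sum_le_sum fun B' hB' => hone B hB B' hB'
          _ = _ := by
              simp only [Finset.sum_const, Finset.card_powerset, nsmul_eq_mul, Nat.cast_pow,
                Nat.cast_ofNat]
              rw [h16]
              ring
      -- With more than `u` free variables the depth condition is discarded and `hyp` bounds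
      -- everything; the prefactor `2 ^ (u + 1)` is at most `2 ^ A.card`.
      · have hΦle : ∀ σ, Φ (starOn S A T.2 σ) ≤ 2 ^ A.card * ∑ B ∈ A.powerset,
            D' σ * G (fixOn (K ∪ S) (ext κ B) σ) := by
          intro σ
          have h1 : Φ (starOn S A T.2 σ) ≤
              D' σ * G (fixOn K κ (starOn S A T.2 σ)) := by
            simp only [hΦ]
            split_ifs
            · exact mul_nonneg (hD'.nonneg _) (hG0 _)
            · exact le_rfl
          refine h1.trans ((mul_le_mul_of_nonneg_left (hGle σ) (hD'.nonneg _)).trans_eq ?_)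
          rw [Finset.mul_sum, Finset.mul_sum, Finset.mul_sum]
          exact Finset.sum_congr rfl fun _ _ => by ring
        have hsum := restrAvg_mono hq0 hq1 hΦle
        simp only [restrAvg_const_mul, restrAvg_sum] at hsum
        have hMD : 0 ≤ M * restrAvg q D' := mul_nonneg hM (restrAvg_nonneg hq0 hq1 hD'.nonneg)
        have h16 : (2 : ℝ) ^ (u + 1) * (2 ^ A.card * 2 ^ A.card) ≤ 16 ^ A.card := by
          have h1 : (2 : ℝ) ^ (u + 1) ≤ 2 ^ A.card :=
            pow_le_pow_right₀ (by norm_num) (by omega)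
          calc (2 : ℝ) ^ (u + 1) * (2 ^ A.card * 2 ^ A.card)
              ≤ 2 ^ A.card * (2 ^ A.card * 2 ^ A.card) := by gcongr
            _ = 8 ^ A.card := by rw [← mul_pow, ← mul_pow]; norm_num
            _ ≤ 16 ^ A.card := by gcongr; norm_num
        calc 2 ^ (u + 1) * restrAvg q (fun σ => Φ (starOn S A T.2 σ))
            ≤ 2 ^ (u + 1) * (2 ^ A.card * ∑ B ∈ A.powerset,
                restrAvg q (fun σ => D' σ * G (fixOn (K ∪ S) (ext κ B) σ))) :=
              mul_le_mul_of_nonneg_left hsum (by positivity)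
          _ ≤ 2 ^ (u + 1) * (2 ^ A.card * ∑ B ∈ A.powerset, M * restrAvg q D') := by
              gcongr with B hB
              exact hyp (K ∪ S) hKS _ _ hD'
          _ = 2 ^ (u + 1) * (2 ^ A.card * 2 ^ A.card) * (M * restrAvg q D') := by
              simp only [Finset.sum_const, Finset.card_powerset, nsmul_eq_mul, Nat.cast_pow,
                Nat.cast_ofNat]
              ring
          _ ≤ _ := mul_le_mul_of_nonneg_right h16 hMD
    have hD0 : 0 ≤ restrAvg q (fun σ => D (starOn S ∅ T.2 σ)) :=
      restrAvg_nonneg hq0 hq1 fun σ => hD.nonneg _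
    have part2 : 2 ^ (u + 1) * restrAvg q (fun σ =>
          if ∀ v ∈ S, σ v ≠ some (!(T.2 v)) then Φ σ else 0) ≤
        M * restrAvg q (fun σ => if ∀ v ∈ S, σ v ≠ some (!(T.2 v)) then D σ else 0) := by
      rw [restrAvg_consistent, restrAvg_consistent, Finset.mul_sum]
      -- On the right only the restrictions satisfying `T` are kept. By monotonicity of `D` they
      -- dominate each pattern `A` on the left.
      have hle : h ^ S.card * restrAvg q (fun σ => D (starOn S ∅ T.2 σ)) ≤
          ∑ A ∈ S.powerset, q ^ A.card * h ^ (S.card - A.card) *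
            restrAvg q (fun σ => D (starOn S A T.2 σ)) := by
        refine le_trans (le_of_eq ?_) (Finset.single_le_sum (f := fun A =>
          q ^ A.card * h ^ (S.card - A.card) * restrAvg q (fun σ => D (starOn S A T.2 σ)))
          (fun A _ => ?_) (Finset.empty_mem_powerset S))
        · simp
        · exact mul_nonneg (mul_nonneg (pow_nonneg hq0 _) (pow_nonneg hh0 _))
            (restrAvg_nonneg hq0 hq1 fun σ => hD.nonneg _)
      refine le_trans ?_ (mul_le_mul_of_nonneg_left hle hM)
      -- The binomial sum without its empty term is `(16 * q + h) ^ S.card - h ^ S.card`, and `hw`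
      -- bounds exactly this by `h ^ S.card`.
      have hbin : ∑ A ∈ S.powerset, q ^ A.card * h ^ (S.card - A.card) *
          (if A = ∅ then (0 : ℝ) else 16 ^ A.card) ≤ h ^ S.card := by
        have h1 : ∑ A ∈ S.powerset, (16 * q) ^ A.card * h ^ (S.card - A.card) =
            (16 * q + h) ^ S.card := by
          rw [← Finset.prod_const, Finset.prod_add]
          refine Finset.sum_congr rfl fun A hA => ?_
          rw [Finset.prod_const, Finset.prod_const,
            Finset.card_sdiff_of_subset (Finset.mem_powerset.1 hA)]
        have h2 : ∑ A ∈ S.powerset, q ^ A.card * h ^ (S.card - A.card) *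
            (if A = ∅ then (0 : ℝ) else 16 ^ A.card) =
            (∑ A ∈ S.powerset, (16 * q) ^ A.card * h ^ (S.card - A.card)) - h ^ S.card := by
          rw [← Finset.add_sum_erase _ _ (Finset.empty_mem_powerset S),
            ← Finset.add_sum_erase _ (fun A => (16 * q) ^ A.card * h ^ (S.card - A.card))
              (Finset.empty_mem_powerset S)]
          simp only [if_true, mul_zero, zero_add, Finset.card_empty, pow_zero, one_mul,
            Nat.sub_zero, add_sub_cancel_left]
          refine Finset.sum_congr rfl fun A hA => ?_
          rw [if_neg (Finset.ne_of_mem_erase hA), mul_pow]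
          ring
        rw [h2, h1]
        have := hw S.card hSw
        linarith
      calc ∑ A ∈ S.powerset, 2 ^ (u + 1) * (q ^ A.card * h ^ (S.card - A.card) *
              restrAvg q (fun σ => Φ (starOn S A T.2 σ)))
          = ∑ A ∈ S.powerset, q ^ A.card * h ^ (S.card - A.card) * (2 ^ (u + 1) *
              restrAvg q (fun σ => Φ (starOn S A T.2 σ))) :=
            Finset.sum_congr rfl fun _ _ => by ring
        _ ≤ ∑ A ∈ S.powerset, q ^ A.card * h ^ (S.card - A.card) *
              ((if A = ∅ then 0 else 16 ^ A.card) *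
                (M * restrAvg q (fun σ => D (starOn S ∅ T.2 σ)))) :=
            Finset.sum_le_sum fun A hA => mul_le_mul_of_nonneg_left (partA A hA)
              (mul_nonneg (pow_nonneg hq0 _) (pow_nonneg hh0 _))
        _ = (∑ A ∈ S.powerset, q ^ A.card * h ^ (S.card - A.card) *
              (if A = ∅ then (0 : ℝ) else 16 ^ A.card)) *
                (M * restrAvg q (fun σ => D (starOn S ∅ T.2 σ))) := by
            rw [Finset.sum_mul]
            exact Finset.sum_congr rfl fun _ _ => by ring
        _ ≤ h ^ S.card * (M * restrAvg q (fun σ => D (starOn S ∅ T.2 σ))) :=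
            mul_le_mul_of_nonneg_right hbin (mul_nonneg hM hD0)
        _ = _ := by ring
    have hsplit : ∀ Ψ : (V → Option Bool) → ℝ, restrAvg q Ψ =
        restrAvg q (fun σ => if ∀ v ∈ S, σ v ≠ some (!(T.2 v)) then 0 else Ψ σ) +
        restrAvg q (fun σ => if ∀ v ∈ S, σ v ≠ some (!(T.2 v)) then Ψ σ else 0) := by
      intro Ψ
      rw [← restrAvg_add]
      congr 1
      funext σ
      split_ifs <;> simp
    rw [hsplit Φ, hsplit D, mul_add, mul_add]
    exact add_le_add part1 part2

open scoped Classical in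
/-- Switching several functions with short certificates simultaneously: if `G` is at most `A`
whenever all the functions `g i` have depth at most `r`, then `G` is at most `2 * A` on average. -/
theorem multi_switching {q : ℝ} (hq0 : 0 ≤ q) (hq1 : q ≤ 1) {w r : ℕ}
    (hw : ∀ a ≤ w, (16 * q + (1 - q) / 2) ^ a ≤ 2 * ((1 - q) / 2) ^ a)
    {G : (V → Option Bool) → ℝ} (hG0 : ∀ σ, 0 ≤ G σ)
    (hG : ∀ σ v, G σ ≤ 2 * (G (Function.update σ v (some true)) +
      G (Function.update σ v (some false))))
    {ι : Type*} (I : Finset ι) (hI : I.card ≤ 2 ^ r) (g : ι → (V → Bool) → Bool)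
    (hg : ∀ i ∈ I, ∃ c, ∀ x, g i x = c →
      ∃ K : Finset V, K.card ≤ w ∧ ∀ y, (∀ v ∈ K, y v = x v) → g i y = c)
    {A : ℝ} (hA0 : 0 ≤ A)
    (hA : ∀ σ, (∀ i ∈ I, HasDepth r fun x => g i (fill σ x)) → G σ ≤ A) :
    restrAvg q G ≤ 2 * A := by
  have hdnf : ∀ i ∈ I, ∃ F : List (Finset V × (V → Bool)), (∀ T ∈ F, T.1.card ≤ w) ∧
      ∀ ρ, HasDepth r (fun x => dnf F (fill ρ x)) → HasDepth r fun x => g i (fill ρ x) := by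
    intro i hi
    obtain ⟨c, hc⟩ := hg i hi
    -- All terms of width at most `w` that force the value `c`: the certificates make their
    -- disjunction equivalent to `g i x = c`.
    let F : List (Finset V × (V → Bool)) := (Finset.univ.filter fun T : Finset V × (V → Bool) =>
      T.1.card ≤ w ∧ ∀ y, (∀ v ∈ T.1, y v = T.2 v) → g i y = c).toList
    have hF : ∀ x, dnf F x = true ↔ g i x = c := by
      intro x
      simp only [dnf, List.any_eq_true, decide_eq_true_eq, F, Finset.mem_toList,
        Finset.mem_filter, Finset.mem_univ, true_and]
      constructor
      · rintro ⟨T, ⟨_, h1⟩, h2⟩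
        exact h1 x h2
      · intro hx
        obtain ⟨K, hK, h1⟩ := hc x hx
        exact ⟨(K, x), ⟨hK, h1⟩, fun _ _ => rfl⟩
    refine ⟨F, fun T hT => ?_, fun ρ hρ => ?_⟩
    · exact ((Finset.mem_filter.1 (Finset.mem_toList.1 hT)).2).1
    · cases c with
      | true =>
        have : ∀ x, g i x = dnf F x := fun x => Bool.eq_iff_iff.2 (hF x).symm
        simpa only [this] using hρ
      | false =>
        have : ∀ x, g i x = !(dnf F x) := by
          intro x
          have := hF x
          cases h1 : g i x <;> cases h2 : dnf F x <;> simp_all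
        simpa only [this] using hρ.not
  choose! F hFw hF using hdnf
  -- Induction on the number of unfixed variables: the bound for larger fixed sets is the hypothesis
  -- of `weighted_switching` with `M = 2 * A`.
  have main : ∀ n (K : Finset V), Kᶜ.card = n → ∀ (κ : V → Bool) (D : (V → Option Bool) → ℝ),
      IsMonoWeight D → restrAvg q (fun σ => D σ * G (fixOn K κ σ)) ≤ 2 * A * restrAvg q D := by
    intro n
    induction n using Nat.strong_induction_on with
    | _ n ih =>
      intro K hK κ D hD
      have hyp : ∀ K', K ⊂ K' → ∀ (κ : V → Bool) (D : (V → Option Bool) → ℝ), IsMonoWeight D →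
          restrAvg q (fun σ => D σ * G (fixOn K' κ σ)) ≤ 2 * A * restrAvg q D := by
        intro K' hK' κ D hD
        refine ih _ ?_ K' rfl κ D hD
        rw [← hK]
        exact Finset.card_lt_card (Finset.compl_ssubset_compl.2 hK')
      have hbad := fun i (hi : i ∈ I) => weighted_switching hq0 hq1 hw hG0 hG
        (mul_nonneg zero_le_two hA0) (F i) (hFw i hi) K hyp κ κ hD r
      have hpt : ∀ σ, D σ * G (fixOn K κ σ) ≤ A * D σ + ∑ i ∈ I,
          if HasDepth r fun x => dnf (F i) (fill (fixOn K κ σ) x) then 0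
          else D σ * G (fixOn K κ σ) := by
        intro σ
        have hnn : ∀ i ∈ I, 0 ≤ if HasDepth r fun x => dnf (F i) (fill (fixOn K κ σ) x) then 0
            else D σ * G (fixOn K κ σ) := by
          intro i _
          split_ifs
          · exact le_rfl
          · exact mul_nonneg (hD.nonneg _) (hG0 _)
        by_cases hall : ∀ i ∈ I, HasDepth r fun x => dnf (F i) (fill (fixOn K κ σ) x)
        · have h1 := hA (fixOn K κ σ) fun i hi => hF i hi _ (hall i hi)
          have h2 := mul_le_mul_of_nonneg_left h1 (hD.nonneg σ)
          have h3 := Finset.sum_nonneg hnn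
          linarith
        · push Not at hall
          obtain ⟨i, hi, hn⟩ := hall
          have h1 := Finset.single_le_sum hnn hi
          rw [if_neg hn] at h1
          have h2 := mul_nonneg hA0 (hD.nonneg σ)
          linarith
      have h1 := restrAvg_mono hq0 hq1 hpt
      rw [restrAvg_add, restrAvg_const_mul, restrAvg_sum] at h1
      have hDn : 0 ≤ A * restrAvg q D := mul_nonneg hA0 (restrAvg_nonneg hq0 hq1 hD.nonneg)
      have h2 := Finset.sum_le_sum hbad
      rw [← Finset.mul_sum, Finset.sum_const, nsmul_eq_mul] at h2
      have h3 : (I.card : ℝ) ≤ 2 ^ r := by exact_mod_cast hI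
      have h4 : (I.card : ℝ) * (2 * A * restrAvg q D) ≤ 2 ^ r * (2 * A * restrAvg q D) :=
        mul_le_mul_of_nonneg_right h3 (by linarith)
      have h5 : (0 : ℝ) < 2 ^ r := by positivity
      have h6 := h2.trans h4
      rw [pow_succ] at h6
      -- Each failure contributes at most `2 * A / 2 ^ (r + 1)` times the average of `D`. The at
      -- most `2 ^ r` failures give `A`, and the good restrictions give the other `A`.
      have h7 : ∑ i ∈ I, restrAvg q (fun σ =>
          if HasDepth r fun x => dnf (F i) (fill (fixOn K κ σ) x) then 0
          else D σ * G (fixOn K κ σ)) ≤ A * restrAvg q D := by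
        refine le_of_mul_le_mul_left ?_ (mul_pos h5 zero_lt_two)
        linarith
      linarith
  have h1 := main _ ∅ rfl (fun _ => false) (fun _ => 1) IsMonoWeight.one
  have h2 : ∀ σ : V → Option Bool, fixOn ∅ (fun _ => false) σ = σ := fun σ => by
    funext v; simp [fixOn]
  have h3 : restrAvg q (fun _ : V → Option Bool => (1 : ℝ)) = 1 := by
    simp only [restrAvg, mul_one]
    rw [← Fintype.piFinset_univ, ← Finset.prod_univ_sum]
    refine Finset.prod_eq_one fun v _ => ?_
    simp [Fintype.sum_option, starWeight]
    ring
  simpa only [h2, one_mul, h3, mul_one] using h1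

end Switching

/-! ### Exponential moments of sensitivity -/

section Sensitivity

variable {V : Type*} [DecidableEq V] [Fintype V]

/-- The sensitivity of `f` at `x`. -/
def sens (f : (V → Bool) → Bool) (x : V → Bool) : ℕ :=
  (Finset.univ.filter fun v => f x ≠ f (Function.update x v (!(x v)))).card

/-- Every sensitive coordinate lies in every certificate at `x`. -/
theorem HasDepth.sens_le {n : ℕ} {f : (V → Bool) → Bool} (h : HasDepth n f) (x : V → Bool) :
    sens f x ≤ n := by
  obtain ⟨K, hK, hc⟩ := h.exists_certificate x
  refine (Finset.card_le_card fun v hv => ?_).trans hK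
  rw [Finset.mem_filter] at hv
  by_contra hvK
  refine hv.2 (hc _ fun u hu => ?_).symm
  have huv : u ≠ v := fun h => hvK (h ▸ hu)
  exact Function.update_of_ne huv _ _

theorem one_add_pow_sens_fill (f : (V → Bool) → Bool) (σ : V → Option Bool) (x : V → Bool)
    (p : ℝ) :
    (1 + p) ^ sens (fun x => f (fill σ x)) x =
      ∏ v, if σ v = none ∧ f (fill σ x) ≠ f (Function.update (fill σ x) v (!(fill σ x v)))
        then 1 + p else 1 := by
  rw [Finset.prod_ite, Finset.prod_const, Finset.prod_const_one, mul_one, sens]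
  congr 2
  refine Finset.filter_congr fun v _ => ?_
  cases h : σ v with
  | none =>
    have h1 : fill σ x v = x v := by simp [fill, h]
    rw [fill_update_none h, h1]
    simp
  | some b =>
    have h1 : fill σ (Function.update x v (!(x v))) = fill σ x := by
      funext u
      by_cases hu : u = v
      · subst hu; simp [fill, h]
      · simp [fill, hu]
    simp [h1]

/-- Each sensitive coordinate stays free in a random restriction with probability `q`. -/
theorem sum_pow_sens_eq_restrAvg (f : (V → Bool) → Bool) (q p : ℝ) :
    ∑ x, (1 + q * p) ^ sens f x =
      restrAvg q (fun σ => ∑ x, (1 + p) ^ sens (fun x => f (fill σ x)) x) := by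
  -- The factor at `v` of the joint weight of a restriction and a filling with result `y`. Given `y
  -- v`, the free case contributes `q * (1 + p)` if `v` is sensitive, and the fixed case `1 - q`,
  -- together `1 + q * p`.
  let t : (V → Bool) → V → Option Bool → Bool → ℝ := fun y v o b =>
    if o.getD b = y v then starWeight q o *
      (if o = none ∧ f y ≠ f (Function.update y v (!(y v))) then 1 + p else 1) else 0
  have h1 : ∀ (σ : V → Option Bool) (x : V → Bool),
      (∏ v, starWeight q (σ v)) * (1 + p) ^ sens (fun x => f (fill σ x)) x =
        ∑ y, ∏ v, t y v (σ v) (x v) := by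
    intro σ x
    rw [Finset.sum_eq_single (fill σ x)]
    · rw [one_add_pow_sens_fill, ← Finset.prod_mul_distrib]
      refine Finset.prod_congr rfl fun v _ => ?_
      simp only [t, fill, if_true]
    · intro y _ hy
      obtain ⟨v, hv⟩ := Function.ne_iff.1 hy
      refine Finset.prod_eq_zero (Finset.mem_univ v) ?_
      exact if_neg fun h => hv h.symm
    · intro h; exact absurd (Finset.mem_univ _) h
  have h2 : ∀ y, ∑ σ : V → Option Bool, ∑ x : V → Bool, ∏ v, t y v (σ v) (x v) =
      (1 + q * p) ^ sens f y := by
    intro y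
    have e1 : ∀ σ : V → Option Bool, ∑ x : V → Bool, ∏ v, t y v (σ v) (x v) =
        ∏ v, ∑ b, t y v (σ v) b := by
      intro σ
      rw [Finset.prod_univ_sum, Fintype.piFinset_univ]
    have e2 : ∑ σ : V → Option Bool, ∏ v, ∑ b, t y v (σ v) b =
        ∏ v, ∑ o, ∑ b, t y v o b := by
      rw [Finset.prod_univ_sum (fun _ => Finset.univ) (fun v o => ∑ b, t y v o b),
        Fintype.piFinset_univ]
    have e3 : ∀ v, ∑ o, ∑ b, t y v o b =
        if f y ≠ f (Function.update y v (!(y v))) then 1 + q * p else 1 := by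
      intro v
      simp only [t, Fintype.sum_option, Fintype.sum_bool, starWeight]
      cases hy : y v <;> simp <;> split_ifs <;> ring
    rw [Finset.sum_congr rfl fun σ _ => e1 σ, e2, Finset.prod_congr rfl fun v _ => e3 v,
      Finset.prod_ite, Finset.prod_const, Finset.prod_const_one, mul_one, sens]
  calc ∑ x, (1 + q * p) ^ sens f x
      = ∑ y, ∑ σ : V → Option Bool, ∑ x : V → Bool, ∏ v, t y v (σ v) (x v) :=
        Finset.sum_congr rfl fun y _ => (h2 y).symm
    _ = ∑ σ : V → Option Bool, ∑ x : V → Bool, ∑ y, ∏ v, t y v (σ v) (x v) := by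
        rw [Finset.sum_comm]
        exact Finset.sum_congr rfl fun σ _ => Finset.sum_comm
    _ = _ := by
        simp only [restrAvg, Finset.mul_sum]
        exact Finset.sum_congr rfl fun σ _ => Finset.sum_congr rfl fun x _ => (h1 σ x).symm

/-- Fixing `v` to the value it already has can only remove `v` itself from the sensitive
coordinates. -/
theorem sens_fill_le (f : (V → Bool) → Bool) (σ : V → Option Bool) (v : V) (x : V → Bool)
    {b : Bool} (hb : fill σ x v = b) :
    sens (fun y => f (fill σ y)) x ≤
      sens (fun y => f (fill (Function.update σ v (some b)) y)) x + 1 := by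
  refine (Finset.card_le_card (t := insert v _) fun u hu => ?_).trans (Finset.card_insert_le _ _)
  by_cases huv : u = v
  · rw [huv]; exact Finset.mem_insert_self _ _
  refine Finset.mem_insert_of_mem ?_
  simp only [Finset.mem_filter, Finset.mem_univ, true_and, fill_update_some] at hu ⊢
  have h1 : fill σ (Function.update x u (!(x u))) v = b := by
    rw [← hb]
    simp [fill, Function.update_of_ne (Ne.symm huv)]
  rw [← hb, Function.update_eq_self]
  rwa [hb, ← h1, Function.update_eq_self]

/-- The growth condition of the switching lemma. For each `x`, the branch agreeing with `fill σ x`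
at `v` loses at most one factor `1 + p ≤ 2`. -/
theorem sum_pow_sens_fill_le (f : (V → Bool) → Bool) {p : ℝ} (hp0 : 0 ≤ p) (hp1 : p ≤ 1)
    (σ : V → Option Bool) (v : V) :
    ∑ x, (1 + p) ^ sens (fun x => f (fill σ x)) x ≤
      2 * (∑ x, (1 + p) ^ sens (fun x => f (fill (Function.update σ v (some true)) x)) x +
        ∑ x, (1 + p) ^ sens (fun x => f (fill (Function.update σ v (some false)) x)) x) := by
  rw [← Finset.sum_add_distrib, Finset.mul_sum]
  refine Finset.sum_le_sum fun x _ => ?_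
  have h1 : ∀ b, fill σ x v = b → (1 + p) ^ sens (fun x => f (fill σ x)) x ≤
      2 * (1 + p) ^ sens (fun x => f (fill (Function.update σ v (some b)) x)) x := by
    intro b hb
    refine (pow_le_pow_right₀ (by linarith) (sens_fill_le f σ v x hb)).trans ?_
    rw [pow_succ, mul_comm]
    exact mul_le_mul_of_nonneg_right (by linarith) (by positivity)
  have hn : ∀ b, 0 ≤ (1 + p) ^ sens (fun x => f (fill (Function.update σ v (some b)) x)) x :=
    fun b => by positivity
  have ht := hn true
  have hf := hn false
  cases hb : fill σ x v <;> linarith [h1 _ hb]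

end Sensitivity

/-! ### Collapsing a circuit level by level -/

namespace BoolCircuit

variable {N : ℕ} (C : BoolCircuit N)

theorem val_of_input {v : Fin C.m} {i : Fin N} (h : C.node v = Node.input i) (x : Fin N → Bool) :
    C.val x v = x i := by
  rw [val]; split <;> simp_all

theorem val_of_not {v u : Fin C.m} (h : C.node v = Node.not u) (x : Fin N → Bool) :
    C.val x v = !(C.val x u) := by
  rw [val]; split <;> simp_all

theorem val_of_and {v : Fin C.m} {S : Finset (Fin C.m)} (h : C.node v = Node.and S)
    (x : Fin N → Bool) : C.val x v = true ↔ ∀ u ∈ S, C.val x u = true := by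
  rw [val]; split <;> simp_all

theorem val_of_or {v : Fin C.m} {S : Finset (Fin C.m)} (h : C.node v = Node.or S)
    (x : Fin N → Bool) : C.val x v = true ↔ ∃ u ∈ S, C.val x u = true := by
  rw [val]; split <;> simp_all

theorem depthAt_child_le {v u : Fin C.m} (hu : u ∈ (C.node v).children) :
    C.depthAt u + (if 1 < (C.node v).fanIn then 1 else 0) ≤ C.depthAt v := by
  rw [depthAt.eq_1 C v]
  exact Nat.add_le_add_right (Finset.le_sup (f := fun u : {u // u ∈ (C.node v).children} =>
    C.depthAt u.1) (Finset.mem_univ ⟨u, hu⟩)) _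

theorem depthAt_of_input {v : Fin C.m} {i : Fin N} (h : C.node v = Node.input i) :
    C.depthAt v = 0 := by
  rw [depthAt]
  have h1 : (C.node v).children = ∅ := by rw [h]; rfl
  have h2 : ¬ 1 < (C.node v).fanIn := by rw [Node.fanIn, h1]; simp
  rw [if_neg h2, add_zero]
  refine (Finset.sup_eq_bot_iff _ _).2 fun u _ => ?_
  exact absurd (h1 ▸ u.2 : u.1 ∈ (∅ : Finset (Fin C.m))) (Finset.notMem_empty _)

variable {V : Type*} [DecidableEq V] (φ : (V → Bool) → Fin N → Bool)

/-- Gates of fan-in at most `1` do not increase the decision tree depth. -/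
theorem hasDepth_of_gates {r j : ℕ}
    (hin : ∀ v i, C.node v = Node.input i → HasDepth r fun x => C.val (φ x) v)
    (hgate : ∀ v, 1 < (C.node v).fanIn → C.depthAt v ≤ j → HasDepth r fun x => C.val (φ x) v)
    (v : Fin C.m) (hv : C.depthAt v ≤ j) : HasDepth r fun x => C.val (φ x) v := by
  induction v using WellFoundedLT.induction with
  | _ v ih =>
    by_cases hf : 1 < (C.node v).fanIn
    · exact hgate v hf hv
    have hchild : ∀ u ∈ (C.node v).children, HasDepth r fun x => C.val (φ x) u := by
      intro u hu
      have := C.depthAt_child_le hu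
      exact ih u (C.topo v u hu) (by omega)
    cases hn : C.node v with
    | input i => exact hin v i hn
    | not u =>
      simp only [C.val_of_not hn]
      exact (hchild u (by rw [hn]; simp [Node.children])).not
    | and S =>
      rw [hn] at hf hchild
      simp only [Node.fanIn, Node.children, not_lt] at hf hchild
      by_cases hS0 : S = ∅
      · refine HasDepth.of_const (fun x y => ?_) r
        rw [(C.val_of_and hn _).2 (by simp [hS0]), (C.val_of_and hn _).2 (by simp [hS0])]
      · have h1 : S.card = 1 :=
          le_antisymm hf (Finset.card_pos.2 (Finset.nonempty_iff_ne_empty.2 hS0))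
        obtain ⟨u, rfl⟩ := Finset.card_eq_one.1 h1
        have : ∀ x, C.val (φ x) v = C.val (φ x) u := fun x =>
          Bool.eq_iff_iff.2 (by rw [C.val_of_and hn]; simp)
        simp only [this]
        exact hchild u (by simp)
    | or S =>
      rw [hn] at hf hchild
      simp only [Node.fanIn, Node.children, not_lt] at hf hchild
      by_cases hS0 : S = ∅
      · refine HasDepth.of_const (fun x y => Bool.eq_iff_iff.2 ?_) r
        rw [C.val_of_or hn, C.val_of_or hn]
        simp [hS0]
      · have h1 : S.card = 1 :=
          le_antisymm hf (Finset.card_pos.2 (Finset.nonempty_iff_ne_empty.2 hS0))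
        obtain ⟨u, rfl⟩ := Finset.card_eq_one.1 h1
        have : ∀ x, C.val (φ x) v = C.val (φ x) u := fun x =>
          Bool.eq_iff_iff.2 (by rw [C.val_of_or hn]; simp)
        simp only [this]
        exact hchild u (by simp)

theorem hasDepth_zero_level (hφ : ∀ i, HasDepth 1 fun x => φ x i) (v : Fin C.m)
    (hv : C.depthAt v ≤ 0) : HasDepth 1 fun x => C.val (φ x) v := by
  refine C.hasDepth_of_gates φ (fun v i h => ?_) (fun v hf h0 => ?_) v hv
  · simp only [C.val_of_input h]
    exact hφ i
  · obtain ⟨u, hu⟩ := Finset.card_pos.1 (zero_lt_one.trans hf)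
    have := C.depthAt_child_le hu
    rw [if_pos hf] at this
    omega

/-- A gate whose inputs have small decision tree depth has small certificates for one of its two
values. -/
theorem exists_certificate_of_gate {w j : ℕ}
    (hφ : ∀ v, C.depthAt v ≤ j → HasDepth w fun x => C.val (φ x) v) (v : Fin C.m)
    (hf : 1 < (C.node v).fanIn) (hv : C.depthAt v ≤ j + 1) :
    ∃ c, ∀ x, C.val (φ x) v = c → ∃ K : Finset V, K.card ≤ w ∧
      ∀ y, (∀ u ∈ K, y u = x u) → C.val (φ y) v = c := by
  have hchild : ∀ u ∈ (C.node v).children, HasDepth w fun x => C.val (φ x) u := by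
    intro u hu
    have := C.depthAt_child_le hu
    rw [if_pos hf] at this
    exact hφ u (by omega)
  cases hn : C.node v with
  | input i => rw [hn] at hf; simp [Node.fanIn, Node.children] at hf
  | not u => rw [hn] at hf; simp [Node.fanIn, Node.children] at hf
  | and S =>
    rw [hn] at hchild
    refine ⟨false, fun x hx => ?_⟩
    rw [← Bool.not_eq_true, C.val_of_and hn] at hx
    push Not at hx
    obtain ⟨u, hu, hxu⟩ := hx
    obtain ⟨K, hK, hc⟩ := (hchild u hu).exists_certificate x
    refine ⟨K, hK, fun y hy => ?_⟩
    rw [← Bool.not_eq_true, C.val_of_and hn]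
    intro h
    exact hxu ((hc y hy).symm.trans (h u hu))
  | or S =>
    rw [hn] at hchild
    refine ⟨true, fun x hx => ?_⟩
    rw [C.val_of_or hn] at hx
    obtain ⟨u, hu, hxu⟩ := hx
    obtain ⟨K, hK, hc⟩ := (hchild u hu).exists_certificate x
    exact ⟨K, hK, fun y hy => (C.val_of_or hn _).2 ⟨u, hu, (hc y hy).trans hxu⟩⟩

variable [Fintype V]

/-- One random restriction reduces the decision tree depth of one more level of the circuit. -/
theorem sum_pow_sens_le_of_next_level {w r j : ℕ} (hwr : w ≤ r) (hs : C.size ≤ 2 ^ r) {q : ℝ}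
    (hq0 : 0 ≤ q) (hq1 : q ≤ 1)
    (hw : ∀ a ≤ w, (16 * q + (1 - q) / 2) ^ a ≤ 2 * ((1 - q) / 2) ^ a)
    {p A : ℝ} (hp0 : 0 ≤ p) (hp1 : p ≤ 1) (hA0 : 0 ≤ A)
    (hnext : ∀ φ : (V → Bool) → Fin N → Bool,
      (∀ v, C.depthAt v ≤ j + 1 → HasDepth r fun x => C.val (φ x) v) →
        ∑ x, (1 + p) ^ sens (fun x => C.eval (φ x)) x ≤ A)
    (hφ : ∀ v, C.depthAt v ≤ j → HasDepth w fun x => C.val (φ x) v) :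
    ∑ x, (1 + q * p) ^ sens (fun x => C.eval (φ x)) x ≤ 2 * A := by
  rw [sum_pow_sens_eq_restrAvg]
  -- All gates of fan-in above `1` up to level `j + 1` are switched together; gates of smaller
  -- fan-in inherit their depth.
  refine multi_switching hq0 hq1 hw (fun σ => Finset.sum_nonneg fun x _ => by positivity)
    (fun σ v => sum_pow_sens_fill_le (fun x => C.eval (φ x)) hp0 hp1 σ v)
    (Finset.univ.filter fun v => 1 < (C.node v).fanIn ∧ C.depthAt v ≤ j + 1)
    (le_trans (Finset.card_le_card fun v hv => ?_) hs) (fun v x => C.val (φ x) v)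
    (fun v hv => ?_) hA0 fun σ hσ => ?_
  · simp only [Finset.mem_filter, Finset.mem_univ, true_and] at hv ⊢
    exact hv.1
  · simp only [Finset.mem_filter, Finset.mem_univ, true_and] at hv
    exact C.exists_certificate_of_gate φ hφ v hv.1 hv.2
  · refine hnext (fun x => φ (fill σ x))
      (C.hasDepth_of_gates _ (fun v i hv => ?_) fun v h1 h2 => ?_)
    · exact ((hφ v (by rw [C.depthAt_of_input hv]; exact Nat.zero_le _)).fill σ).mono hwr
    · exact hσ v (by simp [h1, h2])

/-- Here `e` counts the levels still to collapse. Each costs a factor `2` in the bound and a factor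
`q` in the base; at `e = 0` the output has depth `r` and the base is `2`. -/
theorem sum_pow_sens_le_of_level {r : ℕ} (hs : C.size ≤ 2 ^ r) {q : ℝ} (hq0 : 0 ≤ q) (hq1 : q ≤ 1)
    (hw : ∀ a ≤ r, (16 * q + (1 - q) / 2) ^ a ≤ 2 * ((1 - q) / 2) ^ a) (e j : ℕ)
    (hd : C.depth ≤ j + e) (hφ : ∀ v, C.depthAt v ≤ j → HasDepth r fun x => C.val (φ x) v) :
    ∑ x, (1 + q ^ e) ^ sens (fun x => C.eval (φ x)) x ≤ 2 ^ e * (2 ^ r * 2 ^ Fintype.card V) := by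
  induction e generalizing j φ with
  | zero =>
    have h1 : ∀ x, (1 + q ^ 0) ^ sens (fun x => C.eval (φ x)) x ≤ (2 : ℝ) ^ r := by
      intro x
      rw [pow_zero, one_add_one_eq_two]
      exact pow_le_pow_right₀ one_le_two ((hφ C.out hd).sens_le x)
    refine (Finset.sum_le_sum fun x _ => h1 x).trans_eq ?_
    simp
    ring
  | succ e ih =>
    rw [pow_succ' q, pow_succ' 2, mul_assoc]
    exact C.sum_pow_sens_le_of_next_level φ le_rfl hs hq0 hq1 hw (pow_nonneg hq0 _)
      (pow_le_one₀ hq0 hq1) (by positivity) (fun ψ hψ => ih ψ (j + 1) (by omega) hψ) hφ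

/-- The exponential moment of the sensitivity of a circuit after a substitution in which each
input depends on at most one variable. -/
theorem sum_pow_sens_le {r d : ℕ} (hr : 1 ≤ r) (hs : C.size ≤ 2 ^ r) {q₁ q : ℝ} (hq₁0 : 0 ≤ q₁)
    (hq₁1 : q₁ ≤ 1) (hw₁ : ∀ a ≤ 1, (16 * q₁ + (1 - q₁) / 2) ^ a ≤ 2 * ((1 - q₁) / 2) ^ a)
    (hq0 : 0 ≤ q) (hq1 : q ≤ 1)
    (hw : ∀ a ≤ r, (16 * q + (1 - q) / 2) ^ a ≤ 2 * ((1 - q) / 2) ^ a)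
    (hd : C.depth ≤ d + 1) (hφ : ∀ i, HasDepth 1 fun x => φ x i) :
    ∑ x, (1 + q₁ * q ^ d) ^ sens (fun x => C.eval (φ x)) x ≤
      2 * (2 ^ d * (2 ^ r * 2 ^ Fintype.card V)) := by
  -- At the bottom the gates have certificates of size `1`, so a constant `q₁` suffices. This saves
  -- one factor of `r`.
  refine C.sum_pow_sens_le_of_next_level φ (j := 0) hr hs hq₁0 hq₁1 hw₁ (pow_nonneg hq0 _)
    (pow_le_one₀ hq0 hq1) (by positivity)
    (fun ψ hψ => C.sum_pow_sens_le_of_level ψ hs hq0 hq1 hw d 1 (by omega) hψ) ?_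
  exact C.hasDepth_zero_level φ hφ

end BoolCircuit

/-! ### From block sensitivity to sensitivity, and the tail bound -/

section Blocks

variable {N k : ℕ}

/-- The string obtained from `z` by flipping the blocks `B i` with `y i = true`. -/
def flipBlocks (B : Fin k → Finset (Fin N)) (z : Fin N → Bool) (y : Fin k → Bool) : Fin N → Bool :=
  fun j => if ∃ i, j ∈ B i ∧ y i = true then !(z j) else z j

variable {B : Fin k → Finset (Fin N)}

theorem flipBlocks_of_mem (hB : ∀ i j, i ≠ j → Disjoint (B i) (B j)) {i : Fin k} {j : Fin N}
    (hj : j ∈ B i) (z : Fin N → Bool) (y : Fin k → Bool) :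
    flipBlocks B z y j = if y i = true then !(z j) else z j := by
  refine if_congr ⟨?_, fun h => ⟨i, hj, h⟩⟩ rfl rfl
  rintro ⟨i', hj', h⟩
  by_cases hi : i = i'
  · rwa [hi]
  · exact absurd hj' (Finset.disjoint_left.1 (hB i i' hi) hj)

theorem flipBlocks_of_notMem {j : Fin N} (hj : ∀ i, j ∉ B i) (z : Fin N → Bool)
    (y : Fin k → Bool) : flipBlocks B z y j = z j :=
  if_neg fun ⟨i, h, _⟩ => hj i h

theorem hasDepth_flipBlocks (hB : ∀ i j, i ≠ j → Disjoint (B i) (B j)) (z : Fin N → Bool)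
    (j : Fin N) : HasDepth 1 fun y => flipBlocks B z y j := by
  by_cases h : ∃ i, j ∈ B i
  · obtain ⟨i, hi⟩ := h
    refine Or.inr ⟨i, fun b x y => ?_⟩
    simp [flipBlocks_of_mem hB hi]
  · push Not at h
    exact Or.inl fun x y => by simp only [flipBlocks_of_notMem h]

theorem flipBlocks_involutive (B : Fin k → Finset (Fin N)) (y : Fin k → Bool) :
    Function.Involutive fun z => flipBlocks B z y := by
  intro z
  funext j
  by_cases h : ∃ i, j ∈ B i ∧ y i = true <;> simp [flipBlocks, h]

theorem flipBlocks_false (B : Fin k → Finset (Fin N)) (z : Fin N → Bool) :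
    flipBlocks B z (fun _ => false) = z := by
  funext j
  simp [flipBlocks]

theorem flipBits_flipBlocks (hB : ∀ i j, i ≠ j → Disjoint (B i) (B j)) (z : Fin N → Bool)
    (y : Fin k → Bool) (i : Fin k) :
    flipBits (flipBlocks B z y) (B i) = flipBlocks B z (Function.update y i (!(y i))) := by
  funext j
  by_cases hj : j ∈ B i
  · rw [flipBlocks_of_mem hB hj, flipBits, if_pos hj, flipBlocks_of_mem hB hj]
    cases h : y i <;> simp
  · rw [flipBits, if_neg hj]
    by_cases h : ∃ i', j ∈ B i'
    · obtain ⟨i', hi'⟩ := h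
      have : i' ≠ i := fun h => hj (h ▸ hi')
      rw [flipBlocks_of_mem hB hi', flipBlocks_of_mem hB hi', Function.update_of_ne this]
    · push Not at h
      rw [flipBlocks_of_notMem h, flipBlocks_of_notMem h]

theorem blockSensitivity_flipBlocks (hB : ∀ i j, i ≠ j → Disjoint (B i) (B j))
    (f : (Fin N → Bool) → Bool) (z : Fin N → Bool) (y : Fin k → Bool) :
    blockSensitivity B f (flipBlocks B z y) = sens (fun y => f (flipBlocks B z y)) y := by
  simp only [blockSensitivity, sens, flipBits_flipBlocks hB]

/-- A bound on the exponential moments of the sensitivity after all substitutions that flip blocks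
gives a bound on the exponential moment of the block sensitivity. -/
theorem sum_pow_blockSensitivity_le (hB : ∀ i j, i ≠ j → Disjoint (B i) (B j))
    (f : (Fin N → Bool) → Bool) {a A : ℝ}
    (h : ∀ z, ∑ y, a ^ sens (fun y => f (flipBlocks B z y)) y ≤ A * 2 ^ k) :
    ∑ x, a ^ blockSensitivity B f x ≤ A * 2 ^ N := by
  -- For fixed `y`, flipping blocks permutes the cube, so summing over `z` and `y` counts every
  -- input `2 ^ k` times.
  have h1 : ∀ y : Fin k → Bool, ∑ z, a ^ blockSensitivity B f (flipBlocks B z y) =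
      ∑ x, a ^ blockSensitivity B f x := fun y =>
    Equiv.sum_comp (flipBlocks_involutive B y).toPerm fun x => a ^ blockSensitivity B f x
  have h2 : ∑ y : Fin k → Bool, ∑ z, a ^ blockSensitivity B f (flipBlocks B z y) =
      2 ^ k * ∑ x, a ^ blockSensitivity B f x := by
    rw [Finset.sum_congr rfl fun y _ => h1 y]
    simp
  have h3 : ∑ y : Fin k → Bool, ∑ z, a ^ blockSensitivity B f (flipBlocks B z y) ≤
      2 ^ N * (A * 2 ^ k) := by
    rw [Finset.sum_comm]
    simp only [blockSensitivity_flipBlocks hB]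
    refine (Finset.sum_le_sum fun z _ => h z).trans_eq ?_
    simp
  rw [h2] at h3
  refine le_of_mul_le_mul_left (h3.trans_eq ?_) (by positivity : (0 : ℝ) < 2 ^ k)
  ring

theorem probUniform_le_one (P : (Fin N → Bool) → Prop) : probUniform N P ≤ 1 := by
  classical
  rw [probUniform, div_le_one (by positivity)]
  have h1 := Finset.card_le_univ (Finset.univ.filter P)
  simp only [Fintype.card_fun, Fintype.card_bool, Fintype.card_fin] at h1
  convert (Nat.cast_le (α := ℝ)).2 h1
  simp

/-- Markov's inequality for the exponential moment. -/
theorem probUniform_le_of_sum_pow_le (g : (Fin N → Bool) → ℕ) {p A : ℝ} (hp0 : 0 ≤ p)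
    (hp1 : p ≤ 1) (h : ∑ x, (1 + p) ^ g x ≤ A * 2 ^ N) (t : ℝ) :
    probUniform N (fun x => t ≤ (g x : ℝ)) ≤ A * 2 ^ (-(p * t)) := by
  classical
  -- Bernoulli for exponents in `[0, 1]`; it turns base `1 + p` into base `2`.
  have h2p : (2 : ℝ) ^ p ≤ 1 + p := by
    have := rpow_one_add_le_one_add_mul_self (s := 1) (by norm_num) hp0 hp1
    norm_num at this
    exact this
  have hpt : ∀ x ∈ Finset.univ.filter (fun x => t ≤ (g x : ℝ)),
      (2 : ℝ) ^ (p * t) ≤ (1 + p) ^ g x := by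
    intro x hx
    calc (2 : ℝ) ^ (p * t) ≤ 2 ^ (p * (g x : ℝ)) :=
          Real.rpow_le_rpow_of_exponent_le one_le_two
            (mul_le_mul_of_nonneg_left (Finset.mem_filter.1 hx).2 hp0)
      _ = ((2 : ℝ) ^ p) ^ g x := by rw [Real.rpow_mul zero_le_two, Real.rpow_natCast]
      _ ≤ (1 + p) ^ g x := pow_le_pow_left₀ (by positivity) h2p _
  have h1 : ((Finset.univ.filter fun x => t ≤ (g x : ℝ)).card : ℝ) * 2 ^ (p * t) ≤ A * 2 ^ N := by
    rw [← nsmul_eq_mul, ← Finset.sum_const]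
    refine (Finset.sum_le_sum hpt).trans (le_trans ?_ h)
    exact Finset.sum_le_sum_of_subset_of_nonneg (Finset.filter_subset _ _)
      fun x _ _ => by positivity
  have h3 : probUniform N (fun x => t ≤ (g x : ℝ)) =
      ((Finset.univ.filter fun x => t ≤ (g x : ℝ)).card : ℝ) / 2 ^ N := by
    rw [probUniform]
  rw [h3, Real.rpow_neg zero_le_two, ← div_eq_mul_inv, div_le_div_iff₀ (by positivity)
    (by positivity)]
  exact h1

end Blocks

/-! ### Choice of constants and conclusion -/

/-- With `q = 1 / (100 w)` the ratio of the two bases is at most `1 + 50 q`, whose `w`-th power is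
at most `exp (1 / 2) < 2`. -/
theorem star_prob_bound {w : ℕ} (hw : 1 ≤ w) (a : ℕ) (ha : a ≤ w) :
    (16 * (1 / (100 * (w : ℝ))) + (1 - 1 / (100 * (w : ℝ))) / 2) ^ a ≤
      2 * ((1 - 1 / (100 * (w : ℝ))) / 2) ^ a := by
  have hw1 : (1 : ℝ) ≤ w := by exact_mod_cast hw
  set q : ℝ := 1 / (100 * (w : ℝ)) with hq
  have hqw : q * w = 1 / 100 := by rw [hq]; field_simp
  have hq0 : 0 < q := by rw [hq]; positivity
  have hq1 : q ≤ 1 / 100 := by nlinarith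
  have h1 : 16 * q + (1 - q) / 2 ≤ (1 - q) / 2 * (1 + 50 * q) := by nlinarith
  have h2 : (1 + 50 * q) ^ a ≤ 2 := by
    calc (1 + 50 * q) ^ a ≤ (Real.exp (50 * q)) ^ a :=
          pow_le_pow_left₀ (by positivity) (by linarith [Real.add_one_le_exp (50 * q)]) _
      _ ≤ (Real.exp (50 * q)) ^ w :=
          pow_le_pow_right₀ (Real.one_le_exp (by positivity)) ha
      _ = Real.exp (1 / 2) := by
          rw [← Real.exp_nat_mul]
          congr 1
          linarith
      _ ≤ 2 := by
          have h3 : Real.exp (1 / 2) * Real.exp (1 / 2) = Real.exp 1 := by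
            rw [← Real.exp_add]; norm_num
          nlinarith [Real.exp_one_lt_d9, Real.exp_pos (1 / 2)]
  calc (16 * q + (1 - q) / 2) ^ a ≤ ((1 - q) / 2 * (1 + 50 * q)) ^ a :=
        pow_le_pow_left₀ (by linarith) h1 _
    _ = (1 + 50 * q) ^ a * ((1 - q) / 2) ^ a := by rw [mul_pow]; ring
    _ ≤ 2 * ((1 - q) / 2) ^ a := by
        refine mul_le_mul_of_nonneg_right h2 (pow_nonneg (by linarith) _)

/-- The exponent of the moment bound, compared with the claimed exponent. -/
theorem exponent_bound {L t : ℝ} {r e : ℕ} (hL : 1 ≤ L) (hr : 1 ≤ r) (hrL : (r : ℝ) ≤ 2 * L)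
    (hE : 2 ≤ (1 / 2000 : ℝ) ^ (e + 1) * (t / L ^ (e + 1))) :
    ((e + 1 + r : ℕ) : ℝ) + -(1 / 100 * (1 / (100 * (r : ℝ))) ^ e * t) ≤
      -((1 / 2000 : ℝ) ^ (e + 1) * (t / L ^ (e + 1))) := by
  set E : ℝ := (1 / 2000 : ℝ) ^ (e + 1) * (t / L ^ (e + 1)) with hEdef
  have hL0 : 0 < L := by linarith
  have hr0 : (0 : ℝ) < r := by exact_mod_cast hr
  have ht : 0 ≤ t := by
    by_contra hneg
    push Not at hneg
    have : E ≤ 0 := mul_nonpos_of_nonneg_of_nonpos (by positivity)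
      (div_nonpos_of_nonpos_of_nonneg hneg.le (by positivity))
    linarith
  -- `2000 = 10 * 200`: the `200` covers `100 * r ≤ 200 * L`, and the spare `10 ^ (e + 1) ≥ e + 4`
  -- absorbs the additive `e + 1 + r`.
  have h1 : (10 : ℝ) ^ (e + 1) * E * L = (1 / 200) * (1 / (200 * L)) ^ e * t := by
    have h10 : (10 : ℝ) ^ (e + 1) * (1 / 2000) ^ (e + 1) = (1 / 200) ^ (e + 1) := by
      rw [← mul_pow]; norm_num
    calc (10 : ℝ) ^ (e + 1) * E * L
        = (10 : ℝ) ^ (e + 1) * (1 / 2000) ^ (e + 1) * (t / L ^ (e + 1)) * L := by rw [hEdef]; ring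
      _ = (1 / 200) ^ (e + 1) * (t / L ^ (e + 1)) * L := by rw [h10]
      _ = _ := by
          rw [one_div_pow, one_div_pow, mul_pow]
          field_simp
          ring
  have h2 : (1 / 200) * (1 / (200 * L)) ^ e * t ≤ 1 / 100 * (1 / (100 * (r : ℝ))) ^ e * t := by
    have : 1 / (200 * L) ≤ 1 / (100 * (r : ℝ)) :=
      one_div_le_one_div_of_le (by positivity) (by linarith)
    gcongr
    norm_num
  have h3 : (e : ℝ) + 1 + 3 ≤ 10 ^ (e + 1) := by
    have := one_add_mul_le_pow (a := (9 : ℝ)) (by norm_num) (e + 1)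
    norm_num at this
    have he : (0 : ℝ) ≤ e := Nat.cast_nonneg e
    linarith
  have h4 : ((e : ℝ) + 1 + 3) * (E * L) ≤ 10 ^ (e + 1) * E * L := by
    rw [mul_assoc (10 ^ (e + 1)) E L]
    exact mul_le_mul_of_nonneg_right h3 (mul_nonneg (by linarith) hL0.le)
  have h5 : E ≤ E * L := le_mul_of_one_le_right (by linarith) hL
  have h6 : 2 * L ≤ E * L := mul_le_mul_of_nonneg_right hE hL0.le
  have h7 : (e : ℝ) + 1 ≤ ((e : ℝ) + 1) * (E * L) :=
    le_mul_of_one_le_right (by positivity) (by linarith)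
  push_cast
  linarith

theorem mainTheorem8 :
    ∃ c : ℝ, 0 < c ∧
      ∀ (N s d k : ℕ), 1 ≤ N → 2 ≤ s + N →
      ∀ f ∈ AC0 N s d,
      ∀ B : Fin k → Finset (Fin N), (∀ i j, i ≠ j → Disjoint (B i) (B j)) →
      ∀ t : ℝ,
        probUniform N (fun x => t ≤ (blockSensitivity B f x : ℝ)) ≤
          4 * (N : ℝ) * (2 : ℝ) ^ (-(c ^ d * (t / (Real.logb 2 ((s : ℝ) + (N : ℝ))) ^ d))) := by
  refine ⟨1 / 2000, by norm_num, ?_⟩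
  rintro N s d k hN hsN f ⟨C, -, -, hsize, hdepth, hf⟩ B hB t
  obtain rfl : C.eval = f := funext hf
  have hN1 : (1 : ℝ) ≤ N := by exact_mod_cast hN
  set L : ℝ := Real.logb 2 ((s : ℝ) + (N : ℝ)) with hLdef
  have hsN' : (2 : ℝ) ≤ (s : ℝ) + N := by exact_mod_cast hsN
  have hL : 1 ≤ L := by
    rw [hLdef, Real.le_logb_iff_rpow_le one_lt_two (by linarith)]
    simpa using hsN'
  -- Here the claimed bound is at least `4 * N / 4 ≥ 1`.
  by_cases hE : (1 / 2000 : ℝ) ^ d * (t / L ^ d) ≤ 2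
  · refine (probUniform_le_one _).trans ?_
    have h1 : (2 : ℝ) ^ (-2 : ℝ) ≤ 2 ^ (-((1 / 2000 : ℝ) ^ d * (t / L ^ d))) :=
      Real.rpow_le_rpow_of_exponent_le one_le_two (by linarith)
    have h2 : (2 : ℝ) ^ (-2 : ℝ) = 1 / 4 := by
      rw [Real.rpow_neg zero_le_two]; norm_num
    rw [h2] at h1
    nlinarith
  push Not at hE
  cases d with
  | zero =>
    -- At depth `0` the output depends on at most one block, while `hE` says `t > 2`.
    have hle : ∀ x, blockSensitivity B C.eval x ≤ 1 := by
      intro x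
      have h1 := blockSensitivity_flipBlocks hB C.eval x (fun _ => false)
      rw [flipBlocks_false] at h1
      rw [h1]
      exact (C.hasDepth_zero_level _ (hasDepth_flipBlocks hB x) C.out hdepth).sens_le _
    have hempty : ∀ x, ¬ t ≤ (blockSensitivity B C.eval x : ℝ) := by
      intro x hx
      have h1 : (blockSensitivity B C.eval x : ℝ) ≤ 1 := by exact_mod_cast hle x
      norm_num at hE
      linarith
    have h0 : probUniform N (fun x => t ≤ (blockSensitivity B C.eval x : ℝ)) = 0 := by
      simp [probUniform, hempty]
    rw [h0]
    positivity
  | succ e =>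
    set r : ℕ := ⌈L⌉₊ with hrdef
    have hr1 : 1 ≤ r := Nat.one_le_ceil_iff.2 (by linarith)
    have hrL : (r : ℝ) ≤ 2 * L := by
      have := Nat.ceil_lt_add_one (show 0 ≤ L by linarith)
      linarith
    have hr1' : (1 : ℝ) ≤ r := by exact_mod_cast hr1
    have hsr : C.size ≤ 2 ^ r := by
      have h1 : (s : ℝ) + N ≤ 2 ^ r := by
        calc (s : ℝ) + N = 2 ^ L := (Real.rpow_logb two_pos (by norm_num) (by linarith)).symm
          _ ≤ 2 ^ (r : ℝ) := Real.rpow_le_rpow_of_exponent_le one_le_two (Nat.le_ceil L)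
          _ = 2 ^ r := Real.rpow_natCast _ _
      have h2 : s + N ≤ 2 ^ r := by exact_mod_cast h1
      omega
    have hq0 : (0 : ℝ) ≤ 1 / (100 * (r : ℝ)) := by positivity
    have hq1 : 1 / (100 * (r : ℝ)) ≤ 1 := by
      rw [div_le_one (by positivity)]
      linarith
    have hw₁ : ∀ a ≤ 1, (16 * (1 / 100 : ℝ) + (1 - 1 / 100) / 2) ^ a ≤
        2 * ((1 - 1 / 100) / 2) ^ a := by
      have := star_prob_bound le_rfl
      simpa using this
    have hp0 : (0 : ℝ) ≤ 1 / 100 * (1 / (100 * (r : ℝ))) ^ e := by positivity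
    have hp1 : 1 / 100 * (1 / (100 * (r : ℝ))) ^ e ≤ 1 :=
      mul_le_one₀ (by norm_num) (by positivity) (pow_le_one₀ hq0 hq1)
    have hmom : ∑ x, (1 + 1 / 100 * (1 / (100 * (r : ℝ))) ^ e) ^ blockSensitivity B C.eval x ≤
        2 ^ (e + 1 + r) * 2 ^ N := by
      refine sum_pow_blockSensitivity_le hB C.eval fun z => ?_
      have := C.sum_pow_sens_le (flipBlocks B z) hr1 hsr (by norm_num) (by norm_num) hw₁ hq0 hq1
        (star_prob_bound hr1) hdepth (hasDepth_flipBlocks hB z)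
      refine this.trans_eq ?_
      rw [Fintype.card_fin]
      ring
    refine (probUniform_le_of_sum_pow_le _ hp0 hp1 hmom t).trans ?_
    rw [← Real.rpow_natCast, ← Real.rpow_add two_pos]
    have hexp := Real.rpow_le_rpow_of_exponent_le one_le_two (exponent_bound hL hr1 hrL hE.le)
    refine hexp.trans (le_mul_of_one_le_left (by positivity) (by linarith))
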